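/- **Setting.** Let $X_1,X_2,\dots$ be i.i.d. with law $F_0$, and let $g(X,\theta)\in\mathbb R^m$ be moment functions of $\theta\in\Theta\subset\mathbb R^p$, where $\Theta$ is compact. Write $G(X,\theta)=\partial g(X,\theta)/\partial\theta'$, $F(X,\theta)=\partial\,\mathrm{vec}[G(X,\theta)']/\partial\theta'$ and $\psi(X,\theta)=(g(X,\theta)',\mathrm{vec}[G(X,\theta)']')'\in\mathbb R^{m+mp}$. Let $g(\theta)=E[g(X,\theta)]$, $G(\theta)=E[G(X,\theta)]$, $\Gamma(\theta)=E[\partial\psi(X,\theta)/\partial\theta']$, $\Sigma(\theta)=E[\psi(X,\theta)\psi(X,\theta)']-E[\psi(X,\theta)]E[\psi(X,\theta)]'$. For a fixed symmetric positive definite $m\times m$ matrix $W$ put $$A(W,\theta)=[\,G(\theta)'W\;,\;g(\theta)'W\otimes I_p\,],\qquad V_{GMM}(W,\theta)=(A\Gamma)^{-1}A\,\Sigma\,A'\,((A\Gamma)')^{-1},$$ with all matrices in the last formula taken at $\theta$. Let $g_n,G_n,\psi_n$ be the sample means of $g,G,\psi$ over $X_1,\dots,X_n$, and let $\hat\theta_W=\hat\theta_{GMM}(W)$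 minimize $g_n(\theta)'Wg_n(\theta)$ over $\Theta$. Let $X_1^*,\dots,X_n^*$ be drawn independently, with replacement, from $\{X_1,\dots,X_n\}$; let $g_n^*,G_n^*,\psi_n^*$ be the corresponding means over the bootstrap sample, let $\tilde\psi_n^*(\theta)=\psi_n^*(\theta)-\psi_n(\hat\theta_W)$ and $A_n(W,\hat\theta_W)=[\,G_n(\hat\theta_W)'W\;,\;g_n(\hat\theta_W)'W\otimes I_p\,]$. The symbols $\xrightarrow{p^*}$ and $\xrightarrow{d^*}$ denote convergence in bootstrap probability, and in bootstrap distribution (conditionally on the data), in probability. **Assumptions.** 1. $\theta_W$ is the unique minimizer of $g(\theta)'Wg(\theta)$ over $\Theta$ and lies in the interior of $\Theta$. 2. Almost surely, $g(X,\cdot)$ is twice continuously differentiable near every point of $\Theta$; $E\sup_{\theta\in\Theta}\|g(X,\theta)\|$, $E\sup_{\theta\in\Theta}\|G(X,\theta)\|$, $E\sup_{\theta\in\Theta}\|F(X,\theta)\|$, $E\|g(X,\theta_W)\|^2$ and $E\|G(X,\theta_W)\|^2$ are finite. 3. $A(W,\theta_W)\,E[\psi(X,\theta)-E\psi(X,\theta_W)]\ne0$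 for all $\theta\in\Theta$ with $\theta\neq\theta_W$, and $A(W,\theta_W)\Gamma(\theta_W)$ is nonsingular. 4. $\sup_{\theta\in\Theta}\|g_n^*(\theta)-g_n(\theta)\|\xrightarrow{p^*}0$ and $\sup_{\theta\in\Theta}\|G_n^*(\theta)-G_n(\theta)\|\xrightarrow{p^*}0$. 5. $\sqrt n\,(\psi_n^*(\hat\theta_W)-\psi_n(\hat\theta_W))\xrightarrow{d^*}N(0,\Sigma(\theta_W))$. It is not assumed that $g(\theta)=0$ for some $\theta\in\Theta$, nor that $g(\theta)\neq0$ for all $\theta\in\Theta$: the model may be correctly specified or misspecified. **Conclusion.** Let the double-recentered Hall–Horowitz bootstrap estimator $\hat\theta^*_{DR}$ be a solution in $\Theta$ of $$A_n(W,\hat\theta_W)\,\tilde\psi_n^*(\theta)=0$$ (it is enough that it is one with bootstrap probability tending to one, in probability). Then $$\sqrt n\,(\hat\theta^*_{DR}-\hat\theta_{GMM}(W))\xrightarrow{d^*}N(0,V_{GMM}(W,\theta_W)),$$ and this is the limit law of the GMM estimator: $\sqrt n\,(\hat\theta_{GMM}(W)-\theta_W)\xrightarrow{d}N(0,V_{GMM}(W,\theta_W))$.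 -/

import Mathlib

open MeasureTheory ProbabilityTheory Filter Topology
open scoped Matrix Kronecker ENNReal BoundedContinuousFunction Matrix.Norms.L2Operator

noncomputable section

namespace GMM

/-! ### Derivatives, the augmented moment vector, and matrices attached to it -/

/-- The Jacobian matrix `∂f/∂θ'` at `θ`: rows are indexed by the components of `f`, columns by the
components of `θ`. -/
def jacobian {a b : Type*} [Fintype a] [DecidableEq a] [Fintype b]
    (f : EuclideanSpace ℝ a → EuclideanSpace ℝ b) (θ : EuclideanSpace ℝ a) : Matrix b a ℝ :=
  Matrix.of fun j k => fderiv ℝ f θ (EuclideanSpace.single k 1) j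

section Moments

variable {𝒳 : Type*} {m p : ℕ}
  (g : 𝒳 → EuclideanSpace ℝ (Fin p) → EuclideanSpace ℝ (Fin m))

/-- `G(x, θ) = ∂g(x, θ)/∂θ'`, an `m × p` matrix. -/
def G (x : 𝒳) (θ : EuclideanSpace ℝ (Fin p)) : Matrix (Fin m) (Fin p) ℝ :=
  jacobian (g x) θ

/-- `vec[G(x, θ)']`, a vector of length `mp`. The entry `(j, k)` is `∂g_j/∂θ_k`, and the index
`j` of the moment is the slow one. -/
def vecGT (x : 𝒳) (θ : EuclideanSpace ℝ (Fin p)) : EuclideanSpace ℝ (Fin m × Fin p) :=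
  WithLp.toLp 2 (Matrix.vec (G g x θ)ᵀ)

/-- `F(x, θ) = ∂ vec[G(x, θ)']/∂θ'`, an `mp × p` matrix. -/
def F (x : 𝒳) (θ : EuclideanSpace ℝ (Fin p)) : Matrix (Fin m × Fin p) (Fin p) ℝ :=
  jacobian (vecGT g x) θ

/-- The augmented moment vector `ψ(x, θ) = (g(x, θ), vec[G(x, θ)'])`, of length `m + mp`. -/
def psi (x : 𝒳) (θ : EuclideanSpace ℝ (Fin p)) :
    EuclideanSpace ℝ (Fin m ⊕ Fin m × Fin p) :=
  WithLp.toLp 2 (Sum.elim (g x θ) (vecGT g x θ))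

end Moments

/-- The quadratic form `v'Wv`. -/
def quad {m : ℕ} (W : Matrix (Fin m) (Fin m) ℝ) (v : EuclideanSpace ℝ (Fin m)) : ℝ :=
  v.ofLp ⬝ᵥ (W *ᵥ v.ofLp)

/-- The `p × (m + mp)` matrix `[M'W, v'W ⊗ I_p]` for an `m × p` matrix `M` and an
`m`-vector `v`. -/
def augWeight {m p : ℕ} (W : Matrix (Fin m) (Fin m) ℝ) (M : Matrix (Fin m) (Fin p) ℝ)
    (v : EuclideanSpace ℝ (Fin m)) : Matrix (Fin p) (Fin m ⊕ Fin m × Fin p) ℝ :=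
  Matrix.fromCols (Mᵀ * W)
    ((Matrix.replicateRow Unit (v.ofLp ᵥ* W) ⊗ₖ (1 : Matrix (Fin p) (Fin p) ℝ)).submatrix
      (fun k => ((), k)) id)

/-! ### Population quantities; `F₀` is the distribution of one observation -/

section Population

variable {𝒳 : Type*} [MeasurableSpace 𝒳] {m p : ℕ} (F₀ : Measure 𝒳)
  (g : 𝒳 → EuclideanSpace ℝ (Fin p) → EuclideanSpace ℝ (Fin m))
  (W : Matrix (Fin m) (Fin m) ℝ) (θ : EuclideanSpace ℝ (Fin p))

/-- `g(θ) = E[g(X, θ)]`. -/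
def gPop : EuclideanSpace ℝ (Fin m) := ∫ x, g x θ ∂F₀

/-- `G(θ) = E[G(X, θ)]`. -/
def GPop : Matrix (Fin m) (Fin p) ℝ := Matrix.of fun j k => ∫ x, G g x θ j k ∂F₀

/-- `E[ψ(X, θ)]`. -/
def psiPop : EuclideanSpace ℝ (Fin m ⊕ Fin m × Fin p) := ∫ x, psi g x θ ∂F₀

/-- `Γ(θ) = E[∂ψ(X, θ)/∂θ']`, an `(m + mp) × p` matrix. -/
def GammaPop : Matrix (Fin m ⊕ Fin m × Fin p) (Fin p) ℝ :=
  Matrix.of fun a k => ∫ x, jacobian (psi g x) θ a k ∂F₀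

/-- `A(W, θ) = [G(θ)'W, g(θ)'W ⊗ I_p]`. -/
def APop : Matrix (Fin p) (Fin m ⊕ Fin m × Fin p) ℝ :=
  augWeight W (GPop F₀ g θ) (gPop F₀ g θ)

/-- `Σ(θ) = E[ψ(X, θ) ψ(X, θ)'] - E[ψ(X, θ)] E[ψ(X, θ)]'`. -/
def SigmaPop : Matrix (Fin m ⊕ Fin m × Fin p) (Fin m ⊕ Fin m × Fin p) ℝ :=
  Matrix.of fun a b =>
    (∫ x, psi g x θ a * psi g x θ b ∂F₀) - psiPop F₀ g θ a * psiPop F₀ g θ b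

/-- `V_GMM(W, θ) = (AΓ)⁻¹ A Σ A' ((AΓ)')⁻¹`, all matrices taken at `θ`. -/
def VGMM : Matrix (Fin p) (Fin p) ℝ :=
  (APop F₀ g W θ * GammaPop F₀ g θ)⁻¹ * APop F₀ g W θ * SigmaPop F₀ g θ * (APop F₀ g W θ)ᵀ *
    ((APop F₀ g W θ * GammaPop F₀ g θ)ᵀ)⁻¹

end Population

/-! ### Sample quantities -/

section Sample

variable {𝒳 : Type*} {m p n : ℕ}
  (g : 𝒳 → EuclideanSpace ℝ (Fin p) → EuclideanSpace ℝ (Fin m))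
  (W : Matrix (Fin m) (Fin m) ℝ) (x : Fin n → 𝒳) (θ : EuclideanSpace ℝ (Fin p))

/-- `g_n(θ)` for the sample `x`. -/
def gSample : EuclideanSpace ℝ (Fin m) := (n : ℝ)⁻¹ • ∑ i, g (x i) θ

/-- `G_n(θ)` for the sample `x`. -/
def GSample : Matrix (Fin m) (Fin p) ℝ := (n : ℝ)⁻¹ • ∑ i, G g (x i) θ

/-- `ψ_n(θ) = n⁻¹ ∑ ψ(x_i, θ)` for the sample `x`. -/
def psiSample : EuclideanSpace ℝ (Fin m ⊕ Fin m × Fin p) := (n : ℝ)⁻¹ • ∑ i, psi g (x i) θ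

/-- `A_n(W, θ) = [G_n(θ)'W, g_n(θ)'W ⊗ I_p]` for the sample `x`. -/
def ASample : Matrix (Fin p) (Fin m ⊕ Fin m × Fin p) ℝ :=
  augWeight W (GSample g x θ) (gSample g x θ)

end Sample

/-! ### The nonparametric bootstrap -/

/-- The conditional law, given the data, of the vector of indices drawn by the bootstrap: `n`
independent draws from the uniform distribution on the `n` indices. -/
def bootLaw (n : ℕ) : Measure (Fin n → Fin n) :=
  Measure.pi fun _ => uniformOn (Set.univ : Set (Fin n))

section Boot

variable {𝒳 : Type*} {m p n : ℕ}
  (g : 𝒳 → EuclideanSpace ℝ (Fin p) → EuclideanSpace ℝ (Fin m))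

/-- The bootstrap sample `X*_i = x_{d_i}` obtained from the sample `x` by the drawn
indices `d`. -/
def resample (x : Fin n → 𝒳) (d : Fin n → Fin n) : Fin n → 𝒳 := fun i => x (d i)

/-- The doubly recentered bootstrap moments
`ψ̃*_n(θ) = (g*_n(θ) - g_n(θhat), vec[G*_n(θ)'] - vec[G_n(θhat)'])`. -/
def psiBoot (x : Fin n → 𝒳) (d : Fin n → Fin n) (θhat θ : EuclideanSpace ℝ (Fin p)) :
    EuclideanSpace ℝ (Fin m ⊕ Fin m × Fin p) :=
  psiSample g (resample x d) θ - psiSample g x θhat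

end Boot

section Modes

variable {Ω : Type*} [MeasurableSpace Ω] (μ : Measure Ω)

/-- Convergence to zero in bootstrap probability, in probability: for every `ε > 0`, the conditional
bootstrap probability of `{R_n ≥ ε}` tends to zero in probability. -/
def TendstoZeroInBootProb (R : (n : ℕ) → Ω → (Fin n → Fin n) → ℝ≥0∞) : Prop :=
  ∀ ε : ℝ≥0∞, 0 < ε →
    TendstoInMeasure μ (fun n ω => (bootLaw n).real {d | ε ≤ R n ω d}) atTop (fun _ => (0 : ℝ))

/-- Bootstrap convergence in distribution, in probability, to the law `ν`: for every bounded
continuous `f`, the conditional bootstrap expectation of `f(Z_n)` tends in probability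
to `∫ f dν`. -/
def TendstoInBootDistribution {E : Type*} [TopologicalSpace E] [MeasurableSpace E]
    (Z : (n : ℕ) → Ω → (Fin n → Fin n) → E) (ν : Measure E) : Prop :=
  ∀ f : E →ᵇ ℝ,
    TendstoInMeasure μ (fun n ω => ∫ d, f (Z n ω d) ∂bootLaw n) atTop (fun _ => ∫ z, f z ∂ν)

end Modes

/-- The first `n` observations. -/
def data {Ω 𝒳 : Type*} (X : ℕ → Ω → 𝒳) (n : ℕ) (ω : Ω) : Fin n → 𝒳 := fun i => X i ω

end GMM

end

namespace GMM

/-! ### Suprema of random functions -/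

section Envelope

variable {𝒳 : Type*} [MeasurableSpace 𝒳] {F₀ : Measure 𝒳}
  {E V : Type*} [NormedAddCommGroup E] [NormedAddCommGroup V]

/-! Write `B(a, b) = [M'W, v'W ⊗ I_p] b`, with `v` and `M` the moment and derivative blocks of `a`
(`augBilin`). Both estimators solve a bilinear equation in the augmented moments. The bootstrap
estimator solves `B(ψ_n(θhat), ψ*_n(θ*) - ψ_n(θhat)) = 0` by definition. The GMM first-order
condition is `B(ψ_n(θhat), ψ_n(θhat)) = 0`, and its limit is `B(ψ(θ_W), ψ(θ_W)) = 0`. As `B` is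
symmetric, subtraction gives `B((ψ_n(θhat) + ψ(θ_W))/2, ψ_n(θhat) - ψ(θ_W)) = 0`. So both have the
form `B(c, ψ_n(u) - ψ_n(v) + ζ) = 0`, where `c → ψ(θ_W)` and `√n ζ` has the limit `N(0, Σ)`. This
holds whether or not `g(θ_W) = 0`, hence one variance formula for both cases.

Since `B(ψ(θ_W), ·)` is `A` and `ψ_n(u) - ψ_n(v)` is approximately `Γ(u - v)`, nonsingularity of
`AΓ` gives `u - v = -(AΓ)⁻¹Aζ + o(‖ζ‖)` (`eventually_norm_add_le_of_bilin_eq_zero`). No preliminary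
rate of convergence is needed. A Slutsky argument then transfers the Gaussian limit.

Probability enters through filters. `probFilter` and `bootFilter` turn convergence in probability
and in bootstrap probability into ordinary limits, and `IsLLN` records the weak law along a filter.
Both the data and the resampled data satisfy it, with the same limits (`isLLN_data`,
`IsLLN.resample`), so the uniform law, consistency and linearization are proved once for an
arbitrary filter and used twice. -/

theorem aemeasurable_biSup_of_continuousOn [SecondCountableTopology E] {S : Set E}
    {h : 𝒳 → E → ℝ≥0∞}
    (hmeas : ∀ θ ∈ S, AEMeasurable (fun x => h x θ) F₀)
    (hcont : ∀ᵐ x ∂F₀, ContinuousOn (h x) S) :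
    AEMeasurable (fun x => ⨆ θ ∈ S, h x θ) F₀ := by
  obtain ⟨D, hDc, hDd⟩ := TopologicalSpace.exists_countable_dense S
  have := hDc.to_subtype
  have hD : AEMeasurable (fun x => ⨆ θ : D, h x θ.1) F₀ :=
    AEMeasurable.iSup fun θ => hmeas _ θ.1.2
  refine hD.congr ?_
  filter_upwards [hcont] with x hx
  apply le_antisymm
  · exact iSup_le fun θ => le_iSup₂_of_le θ.1.1 θ.1.2 le_rfl
  · refine iSup₂_le fun θ hθ => ?_
    -- By continuity, the bound by the supremum over `D` defines a closed set; containing a dense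
    -- set, it is all of `S`.
    have hcl : IsClosed {s : S | h x s ≤ ⨆ θ : D, h x θ.1} :=
      isClosed_le hx.domRestrict continuous_const
    have huniv := hcl.closure_subset_iff.2
      (fun s hs => le_iSup (fun θ : D => h x θ.1) ⟨s, hs⟩ : D ⊆ _)
    rw [hDd.closure_eq] at huniv
    exact huniv (Set.mem_univ (⟨θ, hθ⟩ : S))

/-- A random function on `S` that is almost surely continuous and has an integrable envelope. -/
structure IsDominatedOn (F₀ : Measure 𝒳) (S : Set E) (h : 𝒳 → E → V) : Prop where
  aestronglyMeasurable : ∀ θ ∈ S, AEStronglyMeasurable (fun x => h x θ) F₀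
  continuousOn : ∀ᵐ x ∂F₀, ContinuousOn (h x) S
  lintegral_iSup_lt_top : ∫⁻ x, ⨆ θ ∈ S, ‖h x θ‖ₑ ∂F₀ < ∞

namespace IsDominatedOn

variable {S : Set E} {h : 𝒳 → E → V} (H : IsDominatedOn F₀ S h)
include H

theorem integrable {θ : E} (hθ : θ ∈ S) : Integrable (fun x => h x θ) F₀ :=
  ⟨H.aestronglyMeasurable θ hθ, lt_of_le_of_lt
    (lintegral_mono fun _ => le_iSup₂_of_le θ hθ le_rfl) H.lintegral_iSup_lt_top⟩

/-- The oscillation over shrinking balls tends to zero by continuity and is at most twice the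
envelope, so its expectation tends to zero by dominated convergence. The bound `w` does not depend
on `θ`, which is what makes the later estimates uniform. -/
theorem exists_oscillation_le [SecondCountableTopology E] {θ₀ : E} (hθ₀ : θ₀ ∈ S) {η : ℝ}
    (hη : 0 < η) :
    ∃ δ > 0, ∃ w : 𝒳 → ℝ, Integrable w F₀ ∧ ∫ x, w x ∂F₀ < η ∧
      ∀ᵐ x ∂F₀, ∀ θ ∈ S ∩ Metric.ball θ₀ δ, ‖h x θ - h x θ₀‖ ≤ w x := by
  let b : 𝒳 → ℝ≥0∞ := fun x => ⨆ θ ∈ S, ‖h x θ‖ₑ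
  have hb : AEMeasurable b F₀ := aemeasurable_biSup_of_continuousOn
    (fun θ hθ => (H.aestronglyMeasurable θ hθ).enorm)
    (H.continuousOn.mono fun x hx => hx.enorm)
  have hbfin : ∀ᵐ x ∂F₀, b x < ∞ := ae_lt_top' hb H.lintegral_iSup_lt_top.ne
  let w : ℕ → 𝒳 → ℝ≥0∞ := fun k x =>
    ⨆ θ ∈ S ∩ Metric.ball θ₀ (1 / ((k : ℝ) + 1)), ‖h x θ - h x θ₀‖ₑ
  have hw : ∀ k, AEMeasurable (w k) F₀ := fun k => aemeasurable_biSup_of_continuousOn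
    (fun θ hθ => ((H.aestronglyMeasurable θ hθ.1).sub (H.aestronglyMeasurable θ₀ hθ₀)).enorm)
    (H.continuousOn.mono fun x hx =>
      ((hx.mono Set.inter_subset_left).sub continuousOn_const).enorm)
  have hwb : ∀ k x, w k x ≤ 2 * b x := fun k x => by
    refine iSup₂_le fun θ hθ => (enorm_sub_le).trans ?_
    rw [two_mul]
    exact add_le_add (le_iSup₂_of_le θ hθ.1 le_rfl) (le_iSup₂_of_le θ₀ hθ₀ le_rfl)
  have hlim : Tendsto (fun k => ∫⁻ x, w k x ∂F₀) atTop (𝓝 (∫⁻ _, 0 ∂F₀)) := by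
    refine tendsto_lintegral_of_dominated_convergence' (fun x => 2 * b x) hw
      (fun k => Eventually.of_forall (hwb k)) ?_ ?_
    · rw [lintegral_const_mul'' _ hb]
      exact ENNReal.mul_ne_top (by simp) H.lintegral_iSup_lt_top.ne
    · filter_upwards [H.continuousOn] with x hx
      rw [ENNReal.tendsto_atTop_zero]
      intro ε hε
      have hc : ContinuousWithinAt (fun θ => ‖h x θ - h x θ₀‖ₑ) S θ₀ :=
        (((hx θ₀ hθ₀).sub continuousWithinAt_const)).enorm
      have hev : ∀ᶠ θ in 𝓝[S] θ₀, ‖h x θ - h x θ₀‖ₑ < ε := by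
        have := hc.eventually_lt_const (u := ε) (by simpa using hε)
        exact this
      obtain ⟨δ, hδ, hball⟩ := Metric.mem_nhdsWithin_iff.1 hev
      obtain ⟨N, hN⟩ := exists_nat_one_div_lt hδ
      refine ⟨N, fun k hk => iSup₂_le fun θ hθ => (hball ⟨?_, hθ.1⟩).le⟩
      have h1 : 1 / ((k : ℝ) + 1) ≤ 1 / ((N : ℝ) + 1) := by gcongr
      exact (Metric.mem_ball.1 hθ.2).trans_le (h1.trans hN.le)
  rw [lintegral_zero] at hlim
  obtain ⟨k, hk⟩ := (hlim.eventually_lt_const (u := ENNReal.ofReal η) (by simpa using hη)).exists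
  have hkfin : ∫⁻ x, w k x ∂F₀ ≠ ∞ := (hk.trans ENNReal.ofReal_lt_top).ne
  refine ⟨1 / ((k : ℝ) + 1), by positivity, fun x => (w k x).toReal,
    integrable_toReal_of_lintegral_ne_top (hw k) hkfin, ?_, ?_⟩
  · rw [integral_toReal (hw k) (ae_lt_top' (hw k) hkfin)]
    exact (ENNReal.lt_ofReal_iff_toReal_lt hkfin).1 hk
  · filter_upwards [ae_lt_top' (hw k) hkfin] with x hx θ hθ
    rw [← toReal_enorm]
    exact ENNReal.toReal_mono hx.ne (le_iSup₂_of_le (f := fun θ _ => ‖h x θ - h x θ₀‖ₑ) θ hθ le_rfl)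

theorem continuousOn_integral [SecondCountableTopology E] [NormedSpace ℝ V] :
    ContinuousOn (fun θ => ∫ x, h x θ ∂F₀) S := by
  intro θ₀ hθ₀
  rw [ContinuousWithinAt, Metric.tendsto_nhds]
  intro ε hε
  obtain ⟨δ, hδ, w, hw, hwε, hle⟩ := H.exists_oscillation_le hθ₀ hε
  filter_upwards [inter_mem_nhdsWithin S (Metric.ball_mem_nhds θ₀ hδ)] with θ hθ
  rw [dist_eq_norm, ← integral_sub (H.integrable hθ.1) (H.integrable hθ₀)]
  refine lt_of_le_of_lt ?_ hwε
  exact norm_integral_le_of_norm_le hw (hle.mono fun x hx => hx θ hθ)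

end IsDominatedOn

/-- The directional derivative is an almost sure limit of difference quotients. These start at index
`N`, from which on the shifted points lie where measurability is known. -/
theorem aestronglyMeasurable_fderiv_apply [NormedSpace ℝ E] [NormedSpace ℝ V]
    {h : 𝒳 → E → V} {θ₀ : E}
    (hmeas : ∀ᶠ θ in 𝓝 θ₀, AEStronglyMeasurable (fun x => h x θ) F₀)
    (hdiff : ∀ᵐ x ∂F₀, DifferentiableAt ℝ (h x) θ₀) (v : E) :
    AEStronglyMeasurable (fun x => fderiv ℝ (h x) θ₀ v) F₀ := by
  have hlim : Tendsto (fun k : ℕ => θ₀ + ((k : ℝ) + 1)⁻¹ • v) atTop (𝓝 θ₀) := by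
    have h1 : Tendsto (fun k : ℕ => ((k : ℝ) + 1)⁻¹) atTop (𝓝 0) := by
      simpa [one_div] using tendsto_one_div_add_atTop_nhds_zero_nat (𝕜 := ℝ)
    simpa using (tendsto_const_nhds (x := θ₀)).add (h1.smul_const v)
  obtain ⟨N, hN⟩ := eventually_atTop.1 (hlim.eventually hmeas)
  have hmeas₀ : AEStronglyMeasurable (fun x => h x θ₀) F₀ := hmeas.self_of_nhds
  refine aestronglyMeasurable_of_tendsto_ae atTop (f := fun (k : ℕ) x =>
    (((k + N : ℕ) : ℝ) + 1) • (h x (θ₀ + (((k + N : ℕ) : ℝ) + 1)⁻¹ • v) - h x θ₀)) (fun k => ?_) ?_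
  · exact ((hN (k + N) (by lia)).sub hmeas₀).const_smul _
  · filter_upwards [hdiff] with x hx
    have hc : Tendsto (fun k : ℕ => ((k + N : ℕ) : ℝ) + 1) atTop atTop :=
      tendsto_atTop_add_const_right _ _
        (tendsto_natCast_atTop_atTop.comp (tendsto_add_atTop_nat N))
    exact (hx.hasFDerivAt.lim_real v).comp hc

theorem aestronglyMeasurable_clm_of_apply {a : Type*} [Fintype a] [DecidableEq a]
    [NormedSpace ℝ V]
    {φ : 𝒳 → EuclideanSpace ℝ a →L[ℝ] V}
    (hφ : ∀ k, AEStronglyMeasurable (fun x => φ x (EuclideanSpace.single k 1)) F₀) :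
    AEStronglyMeasurable φ F₀ := by
  have heq : φ = fun x => ∑ k, (EuclideanSpace.proj k : EuclideanSpace ℝ a →L[ℝ] ℝ).smulRight
      (φ x (EuclideanSpace.single k 1)) := by
    funext x
    ext v
    conv_lhs => rw [← (EuclideanSpace.basisFun a ℝ).sum_repr v]
    simp [map_sum]
  rw [heq]
  refine Finset.aestronglyMeasurable_fun_sum _ fun k _ => ?_
  exact (ContinuousLinearMap.smulRightL ℝ (EuclideanSpace ℝ a) V
    (EuclideanSpace.proj k)).continuous.comp_aestronglyMeasurable (hφ k)

end Envelope

/-! ### Samples that obey the weak law of large numbers -/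

/-- The mean of `f` over the sample `x`. -/
noncomputable def sampleMean {𝒳 V : Type*} [AddCommGroup V] [Module ℝ V] {n : ℕ}
    (f : 𝒳 → V) (x : Fin n → 𝒳) : V :=
  (n : ℝ)⁻¹ • ∑ i, f (x i)

section SampleMean

variable {𝒳 V V' : Type*} [AddCommGroup V] [Module ℝ V] [AddCommGroup V'] [Module ℝ V'] {n : ℕ}

theorem sampleMean_sub (f f' : 𝒳 → V) (x : Fin n → 𝒳) :
    sampleMean (fun y => f y - f' y) x = sampleMean f x - sampleMean f' x := by
  simp [sampleMean, Finset.sum_sub_distrib, smul_sub]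

theorem map_sampleMean (φ : V →ₗ[ℝ] V') (f : 𝒳 → V) (x : Fin n → 𝒳) :
    φ (sampleMean f x) = sampleMean (fun y => φ (f y)) x := by
  simp [sampleMean]

theorem norm_sampleMean_le {W : Type*} [NormedAddCommGroup W] [NormedSpace ℝ W] {f : 𝒳 → W}
    {w : 𝒳 → ℝ} {x : Fin n → 𝒳} (h : ∀ i, ‖f (x i)‖ ≤ w (x i)) :
    ‖sampleMean f x‖ ≤ sampleMean w x := by
  rw [sampleMean, sampleMean, norm_smul, norm_inv, Real.norm_natCast, smul_eq_mul]
  gcongr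
  exact norm_sum_le_of_le _ fun i _ => h i

end SampleMean

/-- Along `L`, the samples `x` eventually avoid every null set of `F₀`, and the sample means of an
integrable function converge to its expectation. -/
structure IsLLN {𝒳 T : Type*} [MeasurableSpace 𝒳] (F₀ : Measure 𝒳) (L : Filter T) (n : T → ℕ)
    (x : (t : T) → Fin (n t) → 𝒳) : Prop where
  eventually_ae : ∀ P : 𝒳 → Prop, (∀ᵐ y ∂F₀, P y) → ∀ᶠ t in L, ∀ i, P (x t i)
  tendsto_real : ∀ f : 𝒳 → ℝ, Integrable f F₀ →
    Tendsto (fun t => sampleMean f (x t)) L (𝓝 (∫ y, f y ∂F₀))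

namespace IsLLN

variable {𝒳 T : Type*} [MeasurableSpace 𝒳] {F₀ : Measure 𝒳} {L : Filter T} {n : T → ℕ}
  {x : (t : T) → Fin (n t) → 𝒳} (HL : IsLLN F₀ L n x)
  {E V : Type*} [NormedAddCommGroup E] [NormedAddCommGroup V] [NormedSpace ℝ V]
include HL

theorem tendsto [FiniteDimensional ℝ V] {f : 𝒳 → V} (hf : Integrable f F₀) :
    Tendsto (fun t => sampleMean f (x t)) L (𝓝 (∫ y, f y ∂F₀)) := by
  let e := (Module.finBasis ℝ V).equivFunL
  have := FiniteDimensional.complete ℝ V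
  rw [e.toHomeomorph.isInducing.tendsto_nhds_iff, tendsto_pi_nhds]
  intro i
  let φ : V →L[ℝ] ℝ := (ContinuousLinearMap.proj i).comp e.toContinuousLinearMap
  have h := HL.tendsto_real (fun y => φ (f y)) (φ.integrable_comp hf)
  rw [φ.integral_comp_comm hf] at h
  refine h.congr fun t => ?_
  exact (map_sampleMean φ.toLinearMap f (x t)).symm

/-- Uniform law of large numbers. -/
theorem eventually_forall_norm_sampleMean_sub_le [SecondCountableTopology E]
    [FiniteDimensional ℝ V] {S : Set E} {h : 𝒳 → E → V} (H : IsDominatedOn F₀ S h)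
    (hS : IsCompact S) {ε : ℝ} (hε : 0 < ε) :
    ∀ᶠ t in L, ∀ θ ∈ S, ‖sampleMean (fun y => h y θ) (x t) - ∫ y, h y θ ∂F₀‖ ≤ ε := by
  suffices ∀ᶠ t in L, ∀ θ ∈ S, θ ∈ S →
      ‖sampleMean (fun y => h y θ) (x t) - ∫ y, h y θ ∂F₀‖ ≤ ε from
    this.mono fun t ht θ hθ => ht θ hθ hθ
  -- Compactness reduces the claim to a neighbourhood of each `θ₀`. There `ε` splits into `ε/2` for
  -- the sample oscillation, `ε/4` for the law of large numbers at `θ₀` and `ε/4` for the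
  -- oscillation of the expectation.
  refine hS.induction_on (p := fun s => ∀ᶠ t in L, ∀ θ ∈ s, θ ∈ S →
      ‖sampleMean (fun y => h y θ) (x t) - ∫ y, h y θ ∂F₀‖ ≤ ε) (by simp)
    (fun s s' hs h' => h'.mono fun t ht θ hθ => ht θ (hs hθ)) (fun s s' h1 h2 => ?_)
    fun θ₀ hθ₀ => ?_
  · filter_upwards [h1, h2] with t ht1 ht2 θ hθ
    exact hθ.elim (ht1 θ) (ht2 θ)
  · obtain ⟨δ, hδ, w, hw, hwε, hle⟩ := H.exists_oscillation_le hθ₀ (η := ε / 4) (by positivity)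
    refine ⟨S ∩ Metric.ball θ₀ δ, inter_mem_nhdsWithin S (Metric.ball_mem_nhds θ₀ hδ), ?_⟩
    have h1 := (HL.tendsto_real w hw).eventually_lt_const (u := ε / 2) (by linarith)
    have h2 := (Metric.tendsto_nhds.1 (HL.tendsto (H.integrable hθ₀))) (ε / 4) (by positivity)
    filter_upwards [h1, h2, HL.eventually_ae _ hle] with t ht1 ht2 ht3 θ hθ _
    have h3 : ‖sampleMean (fun y => h y θ) (x t) - sampleMean (fun y => h y θ₀) (x t)‖ ≤ ε / 2 := by
      rw [← sampleMean_sub]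
      exact (norm_sampleMean_le fun i => ht3 i θ hθ).trans ht1.le
    have h4 : ‖(∫ y, h y θ₀ ∂F₀) - ∫ y, h y θ ∂F₀‖ ≤ ε / 4 := by
      rw [norm_sub_rev, ← integral_sub (H.integrable hθ.1) (H.integrable hθ₀)]
      exact (norm_integral_le_of_norm_le hw (hle.mono fun x hx => hx θ hθ)).trans hwε.le
    rw [dist_eq_norm] at ht2
    have := norm_add₃_le
      (a := sampleMean (fun y => h y θ) (x t) - sampleMean (fun y => h y θ₀) (x t))
      (b := sampleMean (fun y => h y θ₀) (x t) - ∫ y, h y θ₀ ∂F₀)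
      (c := (∫ y, h y θ₀ ∂F₀) - ∫ y, h y θ ∂F₀)
    rw [sub_add_sub_cancel, sub_add_sub_cancel] at this
    linarith

theorem tendsto_sampleMean_comp [SecondCountableTopology E]
    [FiniteDimensional ℝ V] {S : Set E} {h : 𝒳 → E → V} (H : IsDominatedOn F₀ S h)
    (hS : IsCompact S) {u : T → E} (huS : ∀ᶠ t in L, u t ∈ S) :
    Tendsto (fun t => sampleMean (fun y => h y (u t)) (x t) - ∫ y, h y (u t) ∂F₀) L (𝓝 0) := by
  rw [Metric.tendsto_nhds]
  intro ε hε
  filter_upwards [huS, HL.eventually_forall_norm_sampleMean_sub_le H hS (half_pos hε)] with t h1 h2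
  rw [dist_zero_right]
  linarith [h2 _ h1]

/-- Stochastic differentiability of sample means at an interior point. -/
theorem eventually_norm_sampleMean_sub_sub_le [NormedSpace ℝ E] [SecondCountableTopology E]
    [FiniteDimensional ℝ E] [FiniteDimensional ℝ V]
    {S : Set E} {h : 𝒳 → E → V} {θ₀ : E} (hS : S ∈ 𝓝 θ₀)
    (hdiff : ∀ᵐ y ∂F₀, ∀ θ ∈ S, DifferentiableAt ℝ (h y) θ)
    (H : IsDominatedOn F₀ S fun y θ => fderiv ℝ (h y) θ) {η : ℝ} (hη : 0 < η) :
    ∃ δ > 0, ∀ᶠ t in L, ∀ θ ∈ Metric.ball θ₀ δ, ∀ θ' ∈ Metric.ball θ₀ δ,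
      ‖sampleMean (fun y => h y θ) (x t) - sampleMean (fun y => h y θ') (x t) -
        (∫ y, fderiv ℝ (h y) θ₀ ∂F₀) (θ - θ')‖ ≤ η * ‖θ - θ'‖ := by
  obtain ⟨r, hr, hrS⟩ := Metric.mem_nhds_iff.1 hS
  have hθ₀ : θ₀ ∈ S := mem_of_mem_nhds hS
  obtain ⟨δ₁, hδ₁, w, hw, hwη, hle⟩ := H.exists_oscillation_le hθ₀ (half_pos hη)
  refine ⟨min r δ₁, lt_min hr hδ₁, ?_⟩
  have h1 := (HL.tendsto_real w hw).eventually_lt_const hwη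
  have h2 := (Metric.tendsto_nhds.1 (HL.tendsto (H.integrable hθ₀))) (η / 2) (by positivity)
  filter_upwards [h1, h2, HL.eventually_ae _ hle, HL.eventually_ae _ hdiff]
    with t ht1 ht2 ht3 ht4 θ hθ θ' hθ'
  have hsub : Metric.ball θ₀ (min r δ₁) ⊆ S ∩ Metric.ball θ₀ δ₁ := fun z hz =>
    ⟨hrS (Metric.ball_subset_ball (min_le_left _ _) hz),
      Metric.ball_subset_ball (min_le_right _ _) hz⟩
  -- The mean value inequality is applied to each observation, with the oscillation bound of its
  -- derivative. Averaging gives a bound valid for all pairs `θ, θ'` on one event.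
  have hmv : ∀ i, ‖h (x t i) θ - h (x t i) θ' - fderiv ℝ (h (x t i)) θ₀ (θ - θ')‖ ≤
      w (x t i) * ‖θ - θ'‖ := fun i =>
    Convex.norm_image_sub_le_of_norm_fderiv_le' (fun z hz => ht4 i z (hsub hz).1)
      (fun z hz => ht3 i z (hsub hz)) (convex_ball _ _) hθ' hθ
  have hA : ‖sampleMean (fun y => h y θ) (x t) - sampleMean (fun y => h y θ') (x t) -
      (sampleMean (fun y => fderiv ℝ (h y) θ₀) (x t)) (θ - θ')‖ ≤ η / 2 * ‖θ - θ'‖ := by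
    have e1 := map_sampleMean (ContinuousLinearMap.apply ℝ V (θ - θ')).toLinearMap
      (fun y => fderiv ℝ (h y) θ₀) (x t)
    simp only [ContinuousLinearMap.coe_coe, ContinuousLinearMap.apply_apply] at e1
    rw [e1, ← sampleMean_sub, ← sampleMean_sub]
    refine (norm_sampleMean_le (w := fun y => w y * ‖θ - θ'‖) hmv).trans ?_
    have e2 : sampleMean (fun y => w y * ‖θ - θ'‖) (x t) = sampleMean w (x t) * ‖θ - θ'‖ := by
      simp [sampleMean, Finset.sum_mul, mul_assoc]
    rw [e2]
    gcongr
  have hB : ‖(sampleMean (fun y => fderiv ℝ (h y) θ₀) (x t)) (θ - θ') -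
      (∫ y, fderiv ℝ (h y) θ₀ ∂F₀) (θ - θ')‖ ≤ η / 2 * ‖θ - θ'‖ := by
    rw [← sub_apply]
    refine (ContinuousLinearMap.le_opNorm _ _).trans ?_
    rw [dist_eq_norm] at ht2
    gcongr
  have := norm_add_le_of_le hA hB
  rw [sub_add_sub_cancel] at this
  linarith

end IsLLN

/-! ### Events of probability, and of bootstrap probability, tending to one -/

section Filters

variable {Ω : Type*} [MeasurableSpace Ω] (μ : Measure Ω)

/-- The filter of the events whose probability tends to one. -/
def probFilter : Filter (ℕ × Ω) where
  sets := {S | Tendsto (fun n => μ {ω | (n, ω) ∉ S}) atTop (𝓝 0)}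
  univ_sets := by simp
  sets_of_superset {S S'} hS hSS' := tendsto_of_tendsto_of_tendsto_of_le_of_le tendsto_const_nhds hS
    (fun _ => zero_le) fun n => measure_mono fun ω hω h => hω (hSS' h)
  inter_sets {S S'} hS hS' := by
    have h : Tendsto (fun n => μ {ω | (n, ω) ∉ S} + μ {ω | (n, ω) ∉ S'}) atTop (𝓝 (0 + 0)) :=
      Tendsto.add hS hS'
    rw [add_zero] at h
    refine tendsto_of_tendsto_of_tendsto_of_le_of_le tendsto_const_nhds h
      (fun _ => zero_le) fun n => (measure_mono ?_).trans (measure_union_le _ _)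
    intro ω hω
    by_contra hcon
    simp only [Set.mem_union, Set.mem_ofPred_eq, not_or, not_not] at hcon
    exact hω hcon

variable {μ}

theorem eventually_probFilter {P : ℕ × Ω → Prop} :
    (∀ᶠ t in probFilter μ, P t) ↔ Tendsto (fun n => μ {ω | ¬ P (n, ω)}) atTop (𝓝 0) :=
  Iff.rfl

theorem eventually_probFilter_of_ae {P : ℕ × Ω → Prop} (h : ∀ n, ∀ᵐ ω ∂μ, P (n, ω)) :
    ∀ᶠ t in probFilter μ, P t := by
  rw [eventually_probFilter]
  refine tendsto_const_nhds.congr fun n => (ae_iff.1 (h n)).symm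

/-- This makes the usual calculus of limits, including cluster points and ultrafilters, available
for convergence in probability. -/
theorem tendstoInMeasure_iff_tendsto_probFilter {E : Type*} [PseudoMetricSpace E]
    {f : ℕ → Ω → E} {c : E} :
    TendstoInMeasure μ f atTop (fun _ => c) ↔
      Tendsto (fun t : ℕ × Ω => f t.1 t.2) (probFilter μ) (𝓝 c) := by
  rw [tendstoInMeasure_iff_dist, Metric.tendsto_nhds]
  simp [eventually_probFilter]

theorem tendsto_fst_probFilter : Tendsto Prod.fst (probFilter μ) atTop := by
  rw [tendsto_atTop]
  intro N
  rw [eventually_probFilter]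
  refine tendsto_const_nhds.congr' ?_
  filter_upwards [eventually_ge_atTop N] with n hn
  simp [hn]

/-- Uniqueness of limits in probability depends on this. -/
instance [IsProbabilityMeasure μ] : (probFilter μ).NeBot := by
  refine ⟨fun h => ?_⟩
  have h1 : ∀ᶠ t in probFilter μ, False := by simp [h]
  rw [eventually_probFilter] at h1
  simp only [not_false_eq_true, Set.ofPred_true, measure_univ] at h1
  exact one_ne_zero (tendsto_nhds_unique tendsto_const_nhds h1)

instance (n : ℕ) : IsProbabilityMeasure (bootLaw n) := by
  -- The index `i` itself supplies nonemptiness; for `n = 0` the product is empty and nothing is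
  -- required.
  have : ∀ _ : Fin n, IsProbabilityMeasure (uniformOn (Set.univ : Set (Fin n))) := fun i =>
    have : Nonempty (Fin n) := ⟨i⟩
    inferInstance
  unfold bootLaw
  infer_instance

variable (μ) in
/-- The filter of the events whose bootstrap probability tends to one, in probability. -/
def bootFilter : Filter (Σ n : ℕ, Ω × (Fin n → Fin n)) where
  sets := {S | Tendsto (fun t : ℕ × Ω => (bootLaw t.1).real {d | ⟨t.1, t.2, d⟩ ∉ S})
    (probFilter μ) (𝓝 0)}
  univ_sets := by simpa using tendsto_const_nhds
  sets_of_superset {S S'} hS hSS' := tendsto_of_tendsto_of_tendsto_of_le_of_le tendsto_const_nhds hS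
    (fun _ => measureReal_nonneg) fun n => measureReal_mono fun ω hω h => hω (hSS' h)
  inter_sets {S S'} hS hS' := by
    have h := Tendsto.add hS hS'
    rw [add_zero] at h
    refine tendsto_of_tendsto_of_tendsto_of_le_of_le tendsto_const_nhds h
      (fun _ => measureReal_nonneg) fun n => (measureReal_mono ?_).trans (measureReal_union_le _ _)
    intro ω hω
    by_contra hcon
    simp only [Set.mem_union, Set.mem_ofPred_eq, not_or, not_not] at hcon
    exact hω hcon

theorem eventually_bootFilter {P : (Σ n : ℕ, Ω × (Fin n → Fin n)) → Prop} :
    (∀ᶠ t in bootFilter μ, P t) ↔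
      Tendsto (fun t : ℕ × Ω => (bootLaw t.1).real {d | ¬ P ⟨t.1, t.2, d⟩}) (probFilter μ) (𝓝 0) :=
  Iff.rfl

theorem Eventually.bootFilter {P : ℕ × Ω → Prop} (h : ∀ᶠ t in probFilter μ, P t) :
    ∀ᶠ t in bootFilter μ, P (t.1, t.2.1) := by
  rw [eventually_bootFilter]
  refine (tendsto_const_nhds (x := (0 : ℝ))).congr' ?_
  filter_upwards [h] with t ht
  have : {d : Fin t.1 → Fin t.1 | ¬ P (t.1, t.2)} = ∅ := by
    ext d
    simp only [Set.mem_ofPred_eq, Set.mem_empty_iff_false, iff_false, not_not]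
    exact ht
  rw [this, measureReal_empty]

theorem tendsto_data_bootFilter :
    Tendsto (fun t : Σ n : ℕ, Ω × (Fin n → Fin n) => (t.1, t.2.1)) (bootFilter μ)
      (probFilter μ) :=
  fun _ hS => Eventually.bootFilter hS

end Filters

/-! ### Weak laws of large numbers for the data and for the bootstrap sample -/

section LLN

variable {Ω 𝒳 : Type*}

theorem isLLN_data [MeasurableSpace Ω] [MeasurableSpace 𝒳] {μ : Measure Ω}
    [IsProbabilityMeasure μ] {F₀ : Measure 𝒳} {X : ℕ → Ω → 𝒳} (hX_meas : ∀ i, Measurable (X i))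
    (hX_law : ∀ i, μ.map (X i) = F₀) (hX_indep : iIndepFun X μ) :
    IsLLN F₀ (probFilter μ) (fun t => t.1) (fun t => data X t.1 t.2) := by
  have hae : ∀ P : 𝒳 → Prop, (∀ᵐ y ∂F₀, P y) →
      ∀ᶠ t in probFilter μ, ∀ i, P (data X t.1 t.2 i) := by
    intro P hP
    refine eventually_probFilter_of_ae fun n => ?_
    refine (ae_all_iff (ι := Fin n)).2 fun i => ?_
    exact ae_of_ae_map (hX_meas i).aemeasurable (by rwa [hX_law i])
  refine ⟨hae, fun f hf => ?_⟩
  -- A measurable version is needed to compose with the `X i`; almost surely no observation sees the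
  -- difference.
  let f' := hf.1.mk f
  have hf' : Measurable f' := hf.1.stronglyMeasurable_mk.measurable
  have hint : Integrable f' F₀ := hf.congr hf.1.ae_eq_mk
  have hlaw : ∀ᵐ ω ∂μ, Tendsto (fun n : ℕ => (n : ℝ)⁻¹ • ∑ i ∈ Finset.range n, f' (X i ω)) atTop
      (𝓝 (∫ ω, f' (X 0 ω) ∂μ)) := by
    refine strong_law_ae (fun i ω => f' (X i ω)) ?_ (fun i j hij => ?_) fun i => ?_
    · rw [← hX_law 0] at hint
      exact hint.comp_measurable (hX_meas 0)
    · exact (hX_indep.indepFun hij).comp hf' hf'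
    · have : IdentDistrib (X i) (X 0) μ μ :=
        ⟨(hX_meas i).aemeasurable, (hX_meas 0).aemeasurable, by rw [hX_law, hX_law]⟩
      exact this.comp hf'
  have hint_eq : ∫ ω, f' (X 0 ω) ∂μ = ∫ y, f y ∂F₀ := by
    rw [integral_congr_ae hf.1.ae_eq_mk]
    change _ = ∫ y, f' y ∂F₀
    rw [← integral_map (μ := μ) (hX_meas 0).aemeasurable hf'.aestronglyMeasurable, hX_law 0]
  rw [hint_eq] at hlaw
  have hmeas := tendstoInMeasure_of_tendsto_ae (μ := μ) (fun n => by
    refine (Finset.measurable_fun_sum _ fun i _ => hf'.comp (hX_meas i)).const_smul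
      ((n : ℝ)⁻¹) |>.aestronglyMeasurable) hlaw
  rw [tendstoInMeasure_iff_tendsto_probFilter] at hmeas
  refine hmeas.congr' ?_
  filter_upwards [hae _ hf.1.ae_eq_mk] with t ht
  rw [Finset.sum_range, sampleMean]
  congr 1
  exact Finset.sum_congr rfl fun i _ => (ht i).symm

theorem integral_uniformOn_univ {n : ℕ} (f : Fin n → ℝ) :
    ∫ i, f i ∂(uniformOn (Set.univ : Set (Fin n))) = (n : ℝ)⁻¹ * ∑ i, f i := by
  rw [integral_fintype .of_finite, Finset.mul_sum]
  refine Finset.sum_congr rfl fun i _ => ?_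
  rw [measureReal_def, uniformOn_univ]
  simp

/-- Every drawn index is uniform, so each summand has the sample mean as its bootstrap expectation.
-/
theorem integral_sampleMean_resample {n : ℕ} (f : 𝒳 → ℝ) (x : Fin n → 𝒳) :
    ∫ d, sampleMean f (resample x d) ∂(bootLaw n) = sampleMean f x := by
  rcases n with _ | n
  · simp [sampleMean]
  simp only [sampleMean, resample, smul_eq_mul]
  rw [integral_const_mul, integral_finsetSum _ fun _ _ => .of_finite]
  have h : ∀ i : Fin (n + 1), ∫ d, f (x (d i)) ∂(bootLaw (n + 1)) =
      ((n + 1 : ℕ) : ℝ)⁻¹ * ∑ j, f (x j) := fun i => by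
    rw [← integral_uniformOn_univ fun j => f (x j), bootLaw]
    exact integral_comp_eval (μ := fun _ : Fin (n + 1) => uniformOn (Set.univ : Set (Fin (n + 1))))
      (f := fun j => f (x j)) (measurable_of_finite _).aestronglyMeasurable
  simp only [h]
  rw [Finset.sum_const, Finset.card_univ, Fintype.card_fin, nsmul_eq_mul]
  field_simp

theorem bootLaw_real_le_sampleMean {n : ℕ} {f : 𝒳 → ℝ} (hf : ∀ y, 0 ≤ f y) (x : Fin n → 𝒳) {ε : ℝ}
    (hε : 0 < ε) :
    (bootLaw n).real {d | ε ≤ sampleMean f (resample x d)} ≤ sampleMean f x / ε := by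
  rw [le_div_iff₀ hε, mul_comm, ← integral_sampleMean_resample]
  refine mul_meas_ge_le_integral_of_nonneg (Eventually.of_forall fun d => ?_) .of_finite ε
  exact mul_nonneg (by positivity) (Finset.sum_nonneg fun i _ => hf _)

/-- Chebyshev's inequality: the draws are independent and each summand has bootstrap variance at
most `M ^ 2`. -/
theorem bootLaw_real_le_of_abs_le {n : ℕ} {f : 𝒳 → ℝ} {M : ℝ} (hf : ∀ y, |f y| ≤ M)
    (x : Fin n → 𝒳) {ε : ℝ} (hε : 0 < ε) :
    (bootLaw n).real {d | ε ≤ |sampleMean f (resample x d) - sampleMean f x|} ≤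
      M ^ 2 / ε ^ 2 * (n : ℝ)⁻¹ := by
  have hvar : Var[fun d => sampleMean f (resample x d); bootLaw n] ≤ M ^ 2 * (n : ℝ)⁻¹ := by
    rcases n with _ | n
    · simp only [sampleMean, Finset.univ_eq_empty, Finset.sum_empty, smul_zero, Nat.cast_zero,
        inv_zero, mul_zero]
      exact (variance_zero (bootLaw 0)).le
    have h1 : (fun d => sampleMean f (resample x d)) =
        fun d => ((n + 1 : ℕ) : ℝ)⁻¹ * (∑ i, fun d : Fin (n + 1) → Fin (n + 1) => f (x (d i))) d := by
      funext d
      simp [sampleMean, resample]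
    rw [h1, variance_const_mul, bootLaw,
      variance_sum_pi (X := fun _ j => f (x j)) (fun i => .of_discrete)]
    have h2 : ∀ i : Fin (n + 1),
        Var[fun j => f (x j); uniformOn (Set.univ : Set (Fin (n + 1)))] ≤ M ^ 2 := fun i => by
        refine (variance_le_expectation_sq
          (measurable_of_finite _).aestronglyMeasurable).trans ?_
        refine (integral_mono .of_finite (integrable_const (M ^ 2)) fun j => ?_).trans (by simp)
        exact sq_le_sq' (abs_le.1 (hf _)).1 (abs_le.1 (hf _)).2
    refine (mul_le_mul_of_nonneg_left (Finset.sum_le_sum fun i _ => h2 i) (by positivity)).trans ?_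
    rw [Finset.sum_const, Finset.card_univ, Fintype.card_fin, nsmul_eq_mul]
    apply le_of_eq
    field_simp
  have hcheb := meas_ge_le_variance_div_sq (μ := bootLaw n)
    (X := fun d => sampleMean f (resample x d)) .of_discrete hε
  rw [integral_sampleMean_resample] at hcheb
  refine (ENNReal.toReal_mono ENNReal.ofReal_ne_top hcheb).trans ?_
  rw [ENNReal.toReal_ofReal (div_nonneg (variance_nonneg _ _) (by positivity))]
  calc _ ≤ M ^ 2 * (n : ℝ)⁻¹ / ε ^ 2 := by gcongr
    _ = _ := by ring

/-- An integrable `f` need not have a variance, so it is replaced by a bounded simple function `f'`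
close to it in `L¹`. Chebyshev handles `f'`. Markov handles `|f - f'|`, whose bootstrap mean is a
sample mean controlled by the law for the data. -/
theorem IsLLN.resample [MeasurableSpace Ω] [MeasurableSpace 𝒳] {μ : Measure Ω} {F₀ : Measure 𝒳}
    {X : ℕ → Ω → 𝒳}
    (HL : IsLLN F₀ (probFilter μ) (fun t => t.1) (fun t => data X t.1 t.2)) :
    IsLLN F₀ (bootFilter μ) (fun t => t.1) (fun t => resample (data X t.1 t.2.1) t.2.2) := by
  refine ⟨fun P hP => ?_, fun f hf => ?_⟩
  · filter_upwards [tendsto_data_bootFilter.eventually (HL.eventually_ae P hP)] with t ht i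
    exact ht _
  rw [Metric.tendsto_nhds]
  intro ε hε
  rw [eventually_bootFilter, Metric.tendsto_nhds]
  intro κ hκ
  -- The bound `ε/4` controls the change of the expectation, one of four errors of that size; `ε * κ
  -- / 8` makes Markov's bound at level `ε/4` equal to `κ/2`, leaving `κ/2` for Chebyshev.
  obtain ⟨f', hf'_close, hf'_mem⟩ := (memLp_one_iff_integrable.2 hf).exists_simpleFunc_eLpNorm_sub_lt
    (by simp) (ε := ENNReal.ofReal (min (ε / 4) (ε * κ / 8))) (by
      rw [← pos_iff_ne_zero, ENNReal.ofReal_pos]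
      positivity)
  have hf' : Integrable f' F₀ := memLp_one_iff_integrable.1 hf'_mem
  obtain ⟨M, hM⟩ := f'.exists_forall_norm_le
  have hint : ∫ y, |f y - f' y| ∂F₀ < min (ε / 4) (ε * κ / 8) := by
    have h1 : ENNReal.ofReal (∫ y, ‖f y - f' y‖ ∂F₀) < ENNReal.ofReal (min (ε / 4) (ε * κ / 8)) := by
      have h2 := ofReal_integral_norm_eq_lintegral_enorm (hf.sub hf')
      simp only [Pi.sub_apply] at h2
      rw [h2]
      rwa [eLpNorm_one_eq_lintegral_enorm] at hf'_close
    exact (ENNReal.ofReal_lt_ofReal_iff (by positivity)).1 h1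
  have habs : |(∫ y, f' y ∂F₀) - ∫ y, f y ∂F₀| < ε / 4 := by
    rw [← integral_sub hf' hf]
    refine (abs_integral_le_integral_abs).trans_lt ?_
    simp_rw [abs_sub_comm (f' _)]
    exact hint.trans_le (min_le_left _ _)
  have h1 := (HL.tendsto_real (fun y => |f y - f' y|) (hf.sub hf').abs).eventually_lt_const
    (hint.trans_le (min_le_right _ _))
  have h2 := Metric.tendsto_nhds.1 (HL.tendsto_real f' hf') (ε / 4) (by positivity)
  have h3 : Tendsto (fun t : ℕ × Ω => M ^ 2 / (ε / 4) ^ 2 * (t.1 : ℝ)⁻¹) (probFilter μ) (𝓝 0) := by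
    have := ((tendsto_inv_atTop_zero.comp (tendsto_natCast_atTop_atTop (R := ℝ))).comp
      (tendsto_fst_probFilter (μ := μ))).const_mul (M ^ 2 / (ε / 4) ^ 2)
    simpa using this
  filter_upwards [h1, h2, h3.eventually_lt_const (half_pos hκ)] with t ht1 ht2 ht3
  rw [dist_zero_right, Real.norm_of_nonneg measureReal_nonneg]
  set x := data X t.1 t.2 with hx
  have hsub : {d | ¬ dist (sampleMean f (GMM.resample x d)) (∫ y, f y ∂F₀) < ε} ⊆
      {d | ε / 4 ≤ sampleMean (fun y => |f y - f' y|) (GMM.resample x d)} ∪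
        {d | ε / 4 ≤ |sampleMean f' (GMM.resample x d) - sampleMean f' x|} := by
    intro d hd
    by_contra hcon
    simp only [Set.mem_union, Set.mem_ofPred_eq, not_or, not_le] at hcon
    refine hd ?_
    have h4 := norm_sampleMean_le (f := fun y => f y - f' y) (w := fun y => |f y - f' y|)
      (x := GMM.resample x d) fun i => le_rfl
    rw [sampleMean_sub, Real.norm_eq_abs] at h4
    rw [Real.dist_eq] at ht2 ⊢
    have h5 := abs_add_le (sampleMean f (GMM.resample x d) - sampleMean f' (GMM.resample x d))
      (sampleMean f' (GMM.resample x d) - sampleMean f' x)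
    have h6 := abs_add_le (sampleMean f' x - ∫ y, f' y ∂F₀) ((∫ y, f' y ∂F₀) - ∫ y, f y ∂F₀)
    have h7 := abs_add_le (sampleMean f (GMM.resample x d) - sampleMean f' x)
      (sampleMean f' x - ∫ y, f y ∂F₀)
    simp only [sub_add_sub_cancel] at h5 h6 h7
    linarith [hcon.1, hcon.2]
  calc _ ≤ _ := measureReal_mono hsub
    _ ≤ _ := measureReal_union_le _ _
    _ ≤ _ := add_le_add (bootLaw_real_le_sampleMean (fun y => abs_nonneg _) x (by positivity))
        (bootLaw_real_le_of_abs_le hM x (by positivity))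
    _ < ε * κ / 8 / (ε / 4) + κ / 2 := by gcongr
    _ = κ := by field_simp; norm_num

end LLN

/-! ### Slutsky-type theorems -/

section Cutoff

/-- A continuous cutoff of the indicator function of `{z | R < ‖z‖}`. -/
noncomputable def tailCutoff (V : Type*) [NormedAddCommGroup V] (R : ℝ) : V →ᵇ ℝ :=
  BoundedContinuousFunction.mkOfBound ⟨fun z => min 1 (max 0 (‖z‖ - R)), by fun_prop⟩ 1
    fun z z' => by
      have h : ∀ a : V, 0 ≤ min 1 (max 0 (‖a‖ - R)) ∧ min 1 (max 0 (‖a‖ - R)) ≤ 1 :=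
        fun a => ⟨le_min zero_le_one (le_max_left _ _), min_le_left _ _⟩
      rw [Real.dist_eq, abs_le]
      constructor <;> simp only [ContinuousMap.coe_mk] <;> linarith [h z, h z']

variable {V : Type*} [NormedAddCommGroup V]

theorem tailCutoff_apply (R : ℝ) (z : V) : tailCutoff V R z = min 1 (max 0 (‖z‖ - R)) := rfl

theorem tailCutoff_nonneg (R : ℝ) (z : V) : 0 ≤ tailCutoff V R z :=
  le_min zero_le_one (le_max_left _ _)

/-- Tightness of `ν`, stated with a continuous function so that weak convergence passes the bound on
to the approximating laws. -/
theorem exists_integral_tailCutoff_lt [MeasurableSpace V] [BorelSpace V] {ν : Measure V}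
    [IsProbabilityMeasure ν] {κ : ℝ} (hκ : 0 < κ) :
    ∃ R : ℝ, 0 ≤ R ∧ ∫ z, tailCutoff V R z ∂ν < κ := by
  have h : Tendsto (fun k : ℕ => ∫ z, tailCutoff V (k : ℝ) z ∂ν) atTop (𝓝 (∫ _, (0 : ℝ) ∂ν)) := by
    refine tendsto_integral_of_dominated_convergence (fun _ => 1)
      (fun k => (tailCutoff V k).continuous.aestronglyMeasurable) (integrable_const _)
      (fun k => Eventually.of_forall fun z => ?_) (Eventually.of_forall fun z => ?_)
    · rw [Real.norm_of_nonneg (tailCutoff_nonneg _ _)]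
      exact min_le_left _ _
    · obtain ⟨N, hN⟩ := exists_nat_ge ‖z‖
      refine tendsto_const_nhds.congr' ?_
      filter_upwards [eventually_ge_atTop N] with k hk
      have : ‖z‖ - k ≤ 0 := by
        have : (N : ℝ) ≤ k := by exact_mod_cast hk
        linarith
      rw [tailCutoff_apply, max_eq_left this, min_eq_right zero_le_one]
  rw [integral_zero] at h
  obtain ⟨k, hk⟩ := (h.eventually_lt_const hκ).exists
  exact ⟨k, by positivity, hk⟩

end Cutoff

section Slutsky

variable {Ω : Type*} [MeasurableSpace Ω] {μ : Measure Ω}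
  {V E : Type*} [NormedAddCommGroup V] [NormedSpace ℝ V] [FiniteDimensional ℝ V]
  [MeasurableSpace V] [BorelSpace V]
  [NormedAddCommGroup E] [NormedSpace ℝ E] [MeasurableSpace E] [BorelSpace E]
  {ν : Measure V} [IsProbabilityMeasure ν]

/-- The limit makes `Z` tight, so an error that is `o(‖Z‖)` is negligible, and a continuous `f` is
uniformly continuous near the compact image of a ball. Integrals over the finite set of draws need
no measurability of `T`. -/
theorem TendstoInBootDistribution.of_norm_sub_le
    {Z : (n : ℕ) → Ω → (Fin n → Fin n) → V} {T : (n : ℕ) → Ω → (Fin n → Fin n) → E}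
    (hZ : TendstoInBootDistribution μ Z ν) (M : V →L[ℝ] E)
    (hT : ∀ η > 0, ∀ᶠ t in bootFilter μ,
      ‖T t.1 t.2.1 t.2.2 - M (Z t.1 t.2.1 t.2.2)‖ ≤ η * ‖Z t.1 t.2.1 t.2.2‖) :
    TendstoInBootDistribution μ T (ν.map M) := by
  have : ProperSpace V := FiniteDimensional.proper ℝ V
  intro f
  rw [tendstoInMeasure_iff_tendsto_probFilter, Metric.tendsto_nhds]
  intro ε hε
  rw [integral_map M.continuous.measurable.aemeasurable f.continuous.aestronglyMeasurable]
  -- Off the good event `f` changes by at most `2‖f‖`; with this `κ`, the tail of `Z` and the bad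
  -- set `B` each cost at most `ε/4`.
  set κ : ℝ := ε / (8 * (‖f‖ + 1)) with hκ_def
  have hκ : 0 < κ := by positivity
  have hκf : 2 * ‖f‖ * κ ≤ ε / 4 := by
    rw [hκ_def, mul_div_assoc', div_le_div_iff₀ (by positivity) (by norm_num)]
    nlinarith [norm_nonneg f]
  obtain ⟨R, hR, hRκ⟩ := exists_integral_tailCutoff_lt (ν := ν) hκ
  have hK : IsCompact (M '' Metric.closedBall 0 (R + 1)) :=
    (isCompact_closedBall _ _).image M.continuous
  have hunif := hK.uniformContinuousAt_of_continuousAt f (fun a _ => f.continuous.continuousAt)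
    (Metric.dist_mem_uniformity (show 0 < ε / 4 by positivity))
  obtain ⟨δ, hδ, hδf⟩ := Metric.mem_uniformity_dist.1 hunif
  -- The cutoff reaches the value `1` only at norm `R + 1`. Inside that ball this choice makes the
  -- error at most `δ/2`.
  have hgood := hT (δ / (2 * (R + 1))) (by positivity)
  rw [eventually_bootFilter] at hgood
  have h1 := (tendstoInMeasure_iff_tendsto_probFilter.1 (hZ (tailCutoff V R))).eventually_lt_const
    hRκ
  have h2 := Metric.tendsto_nhds.1 (tendstoInMeasure_iff_tendsto_probFilter.1
    (hZ (f.compContinuous ⟨M, M.continuous⟩))) (ε / 4) (by positivity)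
  filter_upwards [h1, h2, hgood.eventually_lt_const hκ] with t ht1 ht2 ht3
  set P := bootLaw t.1
  set B : Set (Fin t.1 → Fin t.1) := {d | ¬ ‖T t.1 t.2 d - M (Z t.1 t.2 d)‖ ≤
    δ / (2 * (R + 1)) * ‖Z t.1 t.2 d‖} with hB
  have hpt : ∀ d, ‖f (T t.1 t.2 d) - f (M (Z t.1 t.2 d))‖ ≤
      ε / 4 + 2 * ‖f‖ * tailCutoff V R (Z t.1 t.2 d) + 2 * ‖f‖ * B.indicator 1 d := by
    intro d
    have hbd : ‖f (T t.1 t.2 d) - f (M (Z t.1 t.2 d))‖ ≤ 2 * ‖f‖ := by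
      rw [two_mul]
      exact norm_sub_le_of_le (f.norm_coe_le_norm _) (f.norm_coe_le_norm _)
    have hc := tailCutoff_nonneg R (Z t.1 t.2 d)
    have hf0 := norm_nonneg f
    by_cases hd : d ∈ B
    · rw [Set.indicator_of_mem hd]
      simp only [Pi.one_apply]
      have : 0 ≤ 2 * ‖f‖ * tailCutoff V R (Z t.1 t.2 d) := by positivity
      linarith
    · rw [Set.indicator_of_notMem hd]
      by_cases hZR : ‖Z t.1 t.2 d‖ ≤ R + 1
      · have hd' : ‖T t.1 t.2 d - M (Z t.1 t.2 d)‖ ≤ δ / (2 * (R + 1)) * ‖Z t.1 t.2 d‖ := by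
          simpa [hB] using hd
        have hlt : dist (M (Z t.1 t.2 d)) (T t.1 t.2 d) < δ := by
          rw [dist_comm, dist_eq_norm]
          refine hd'.trans_lt ?_
          calc _ ≤ δ / (2 * (R + 1)) * (R + 1) := by gcongr
            _ = δ / 2 := by field_simp
            _ < δ := by linarith
        have h3 : dist (f (M (Z t.1 t.2 d))) (f (T t.1 t.2 d)) < ε / 4 :=
          hδf hlt ⟨_, by simpa using hZR, rfl⟩
        rw [dist_comm, dist_eq_norm] at h3
        have : 0 ≤ 2 * ‖f‖ * tailCutoff V R (Z t.1 t.2 d) := by positivity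
        linarith
      · have : tailCutoff V R (Z t.1 t.2 d) = 1 := by
          rw [tailCutoff_apply, min_eq_left]
          exact le_max_of_le_right (by linarith)
        rw [this]
        linarith
  have hint : ‖(∫ d, f (T t.1 t.2 d) ∂P) - ∫ d, f (M (Z t.1 t.2 d)) ∂P‖ ≤
      ε / 4 + 2 * ‖f‖ * (∫ d, tailCutoff V R (Z t.1 t.2 d) ∂P) + 2 * ‖f‖ * P.real B := by
    rw [← integral_sub .of_finite .of_finite]
    refine (norm_integral_le_of_norm_le .of_finite (Eventually.of_forall hpt)).trans_eq ?_
    rw [integral_add .of_finite .of_finite, integral_add .of_finite .of_finite,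
      integral_const_mul, integral_const_mul, integral_indicator_one (.of_discrete)]
    simp
  have h4 : 2 * ‖f‖ * (∫ d, tailCutoff V R (Z t.1 t.2 d) ∂P) ≤ 2 * ‖f‖ * κ := by gcongr
  have h5 : 2 * ‖f‖ * P.real B ≤ 2 * ‖f‖ * κ := by gcongr
  rw [dist_eq_norm] at ht2 ⊢
  have h6 := norm_add_le ((∫ d, f (T t.1 t.2 d) ∂P) - ∫ d, f (M (Z t.1 t.2 d)) ∂P)
    ((∫ d, f (M (Z t.1 t.2 d)) ∂P) - ∫ z, f (M z) ∂ν)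
  rw [sub_add_sub_cancel] at h6
  have h7 : ‖(∫ d, f (M (Z t.1 t.2 d)) ∂P) - ∫ z, f (M z) ∂ν‖ < ε / 4 := ht2
  linarith

/-- The error divided by `1 + ‖Z‖` tends to zero in probability, and `T` is a continuous function of
`Z` and this quotient, so Slutsky's theorem applies. -/
theorem tendstoInDistribution_of_norm_sub_le [IsProbabilityMeasure μ] [FiniteDimensional ℝ E]
    {Z : ℕ → Ω → V} {T : ℕ → Ω → E}
    (hZ : TendstoInDistribution Z atTop id (fun _ => μ) ν) (M : V →L[ℝ] E)
    {ν' : Measure E} [IsProbabilityMeasure ν'] (hν' : ν.map M = ν')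
    (hT_meas : ∀ n, AEMeasurable (T n) μ)
    (hT : ∀ η > 0, ∀ᶠ t in probFilter μ, ‖T t.1 t.2 - M (Z t.1 t.2)‖ ≤ η * ‖Z t.1 t.2‖) :
    TendstoInDistribution T atTop id (fun _ => μ) ν' := by
  let Y : ℕ → Ω → E := fun n ω => (1 + ‖Z n ω‖)⁻¹ • (T n ω - M (Z n ω))
  have hY : TendstoInMeasure μ Y atTop (fun _ => 0) := by
    rw [tendstoInMeasure_iff_tendsto_probFilter, Metric.tendsto_nhds]
    intro ε hε
    filter_upwards [hT (ε / 2) (by positivity)] with t ht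
    rw [dist_zero_right, norm_smul, norm_inv, Real.norm_of_nonneg (by positivity),
      inv_mul_lt_iff₀ (by positivity)]
    nlinarith [norm_nonneg (Z t.1 t.2)]
  have hY_meas : ∀ n, AEMeasurable (Y n) μ := fun n => by
    have hZn := hZ.forall_aemeasurable n
    have hTn := hT_meas n
    have hMZ : AEMeasurable (fun ω => M (Z n ω)) μ :=
      M.continuous.measurable.comp_aemeasurable hZn
    exact (hZn.norm.const_add 1).inv.smul (hTn.sub hMZ)
  have h := hZ.continuous_comp_prodMk_of_tendstoInMeasure_const
    (g := fun q : V × E => M q.1 + (1 + ‖q.1‖) • q.2) (by fun_prop) hY hY_meas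
  have hT_eq : (fun n ω => M (Z n ω) + (1 + ‖Z n ω‖) • Y n ω) = T := by
    funext n ω
    have : (1 + ‖Z n ω‖) ≠ 0 := by positivity
    simp only [Y, smul_inv_smul₀ this]
    abel
  simp only [hT_eq, id_eq, smul_zero, add_zero] at h
  refine ⟨hT_meas, aemeasurable_id, ?_⟩
  have h' := h.tendsto
  convert h' using 2
  ext1
  simp [hν']

end Slutsky

/-! ### Gaussian limits -/

section Gaussian

/-- Characteristic functions determine the law, and moving `M` across the inner product evaluates
the first one at `Mᵀ t`. -/
theorem map_multivariateGaussian {a b : Type*} [Fintype a] [DecidableEq a] [Fintype b]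
    [DecidableEq b] {S : Matrix a a ℝ} (hS : S.PosSemidef) (M : Matrix b a ℝ) :
    (multivariateGaussian 0 S).map (Matrix.toEuclideanLin M).toContinuousLinearMap =
      multivariateGaussian 0 (M * S * Mᵀ) := by
  have hMS : (M * S * Mᵀ).PosSemidef := by
    simpa using hS.mul_mul_conjTranspose_same M
  refine Measure.ext_of_charFun (funext fun t => ?_)
  rw [charFun_multivariateGaussian hMS, charFun_apply,
    integral_map (by fun_prop) (by fun_prop)]
  have h1 : ∀ x : EuclideanSpace ℝ a,
      inner ℝ ((Matrix.toEuclideanLin M).toContinuousLinearMap x) t =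
        inner ℝ x (WithLp.toLp 2 (Mᵀ *ᵥ t.ofLp)) := fun x => by
    simp only [EuclideanSpace.inner_eq_star_dotProduct, star_trivial,
      LinearMap.coe_toContinuousLinearMap', Matrix.toLpLin_apply]
    rw [Matrix.dotProduct_mulVec, Matrix.mulVec_transpose]
  simp_rw [h1]
  rw [← charFun_apply, charFun_multivariateGaussian hS]
  congr 2
  · simp
  · simp only [Matrix.mulVec_transpose]
    congr 2
    rw [← Matrix.dotProduct_mulVec, Matrix.mulVec_mulVec, ← Matrix.mulVec_transpose,
      Matrix.mulVec_mulVec]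

/-- The covariance matrix of `φ`. -/
noncomputable def covMatrix {𝒳 a : Type*} [MeasurableSpace 𝒳] [Fintype a] (F₀ : Measure 𝒳)
    (φ : 𝒳 → EuclideanSpace ℝ a) : Matrix a a ℝ :=
  Matrix.of fun i j =>
    (∫ x, φ x i * φ x j ∂F₀) - (∫ x, φ x ∂F₀) i * (∫ x, φ x ∂F₀) j

/-! ### The multivariate central limit theorem -/

section CLT

variable {𝒳 a : Type*} [Fintype a]

theorem inner_sqrt_smul_sampleMean_sub {Ω : Type*} (φ : 𝒳 → EuclideanSpace ℝ a) (X : ℕ → Ω → 𝒳)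
    (n : ℕ) (ω : Ω) (c t : EuclideanSpace ℝ a) :
    inner ℝ (√(n : ℝ) • (sampleMean φ (data X n ω) - c)) t =
      (√(n : ℝ))⁻¹ * (∑ k ∈ Finset.range n, inner ℝ (φ (X k ω)) t - n * inner ℝ c t) := by
  rw [inner_smul_left, inner_sub_left, sampleMean, inner_smul_left, sum_inner, Finset.sum_range]
  simp only [data, conj_trivial]
  rcases n with _ | n
  · simp
  · have hs : √((n + 1 : ℕ) : ℝ) ≠ 0 := by positivity
    have hs2 : √((n + 1 : ℕ) : ℝ) ^ 2 = ((n + 1 : ℕ) : ℝ) := Real.sq_sqrt (by positivity)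
    field_simp
    rw [hs2]

variable [MeasurableSpace 𝒳] {F₀ : Measure 𝒳} [IsProbabilityMeasure F₀]
  {φ : 𝒳 → EuclideanSpace ℝ a}

/-- Bilinearity of the covariance. It yields positive semidefiniteness and identifies the variance
of each one-dimensional projection. -/
theorem dotProduct_covMatrix_mulVec (hφ : MemLp φ 2 F₀) (t : EuclideanSpace ℝ a) :
    t.ofLp ⬝ᵥ covMatrix F₀ φ *ᵥ t.ofLp = Var[fun x => inner ℝ (φ x) t; F₀] := by
  have hφi : ∀ i, MemLp (fun x => φ x i) 2 F₀ := fun i =>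
    (EuclideanSpace.proj (𝕜 := ℝ) i).comp_memLp' hφ
  have hmean : ∀ i, (∫ x, φ x ∂F₀) i = ∫ x, φ x i ∂F₀ := fun i =>
    ((EuclideanSpace.proj (𝕜 := ℝ) i).integral_comp_comm (hφ.integrable (by norm_num))).symm
  have hcov : ∀ i j, covMatrix F₀ φ i j = cov[fun x => φ x i, fun x => φ x j; F₀] := fun i j => by
    rw [covariance_eq_sub (hφi i) (hφi j), covMatrix, Matrix.of_apply, hmean, hmean]
    rfl
  have hinner : (fun x => inner ℝ (φ x) t) = fun x => ∑ i, t i * φ x i := by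
    funext x
    simp [PiLp.inner_apply]
  rw [hinner, variance_fun_sum fun i => (hφi i).const_mul _]
  simp only [covariance_const_mul_left, covariance_const_mul_right, dotProduct, Matrix.mulVec,
    Finset.mul_sum, hcov]
  exact Finset.sum_congr rfl fun i _ => Finset.sum_congr rfl fun j _ => by ring

theorem posSemidef_covMatrix (hφ : MemLp φ 2 F₀) : (covMatrix F₀ φ).PosSemidef := by
  refine Matrix.PosSemidef.of_dotProduct_mulVec_nonneg ?_ fun v => ?_
  · ext i j
    simp [covMatrix, mul_comm]
  · have := dotProduct_covMatrix_mulVec hφ (WithLp.toLp 2 v)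
    simp only [star_trivial]
    rw [this]
    exact variance_nonneg _ _

theorem tendsto_charFun_inv_sqrt_mul_sum_sub {Ω : Type*} [MeasurableSpace Ω] {μ : Measure Ω}
    [IsProbabilityMeasure μ] {Y : ℕ → Ω → ℝ} (hY : MemLp (Y 0) 2 μ) (hindep : iIndepFun Y μ)
    (hident : ∀ i, IdentDistrib (Y i) (Y 0) μ μ) :
    Tendsto (fun n : ℕ => charFun
        (μ.map fun ω => (√(n : ℝ))⁻¹ * (∑ k ∈ Finset.range n, Y k ω - n * ∫ ω, Y 0 ω ∂μ)) 1)
      atTop (𝓝 (Complex.exp (-(Var[Y 0; μ] : ℂ) / 2))) := by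
  have hclt := tendstoInDistribution_inv_sqrt_mul_sum_sub (Y := (id : ℝ → ℝ))
    (P' := gaussianReal 0 Var[Y 0; μ].toNNReal) HasLaw.id hY hindep hident
  have h1 := ProbabilityMeasure.tendsto_iff_tendsto_charFun.1 hclt.tendsto 1
  have h2 : charFun ((gaussianReal 0 Var[Y 0; μ].toNNReal).map id) 1 =
      Complex.exp (-(Var[Y 0; μ] : ℂ) / 2) := by
    rw [Measure.map_id, charFun_gaussianReal, Real.coe_toNNReal _ (variance_nonneg _ _)]
    congr 1
    simp
    ring
  rw [← h2]
  exact h1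

/-- The multivariate central limit theorem. -/
theorem tendstoInDistribution_sqrt_smul_sampleMean_sub {Ω : Type*} [MeasurableSpace Ω]
    {μ : Measure Ω} [IsProbabilityMeasure μ] [DecidableEq a] {X : ℕ → Ω → 𝒳}
    (hX_meas : ∀ i, Measurable (X i)) (hX_law : ∀ i, μ.map (X i) = F₀)
    (hX_indep : iIndepFun X μ) (hφ : MemLp φ 2 F₀) :
    TendstoInDistribution
      (fun (n : ℕ) ω => √(n : ℝ) • (sampleMean φ (data X n ω) - ∫ x, φ x ∂F₀)) atTop id
      (fun _ => μ) (multivariateGaussian 0 (covMatrix F₀ φ)) := by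
  have hφX : ∀ i, AEMeasurable (fun ω => φ (X i ω)) μ := fun i => by
    have h := hφ.1.aemeasurable
    rw [← hX_law i] at h
    exact h.comp_measurable (hX_meas i)
  have hZ_meas : ∀ n : ℕ, AEMeasurable
      (fun ω => √(n : ℝ) • (sampleMean φ (data X n ω) - ∫ x, φ x ∂F₀)) μ := fun n => by
    have hsum : AEMeasurable (fun ω => ∑ i : Fin n, φ (X i ω)) μ :=
      Finset.aemeasurable_fun_sum _ fun i _ => hφX _
    exact ((hsum.const_smul (n : ℝ)⁻¹).sub_const (∫ x, φ x ∂F₀)).const_smul (√(n : ℝ))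
  -- Lévy continuity with the Cramér–Wold device: the characteristic function at `t` is that of the
  -- projection on `t`, taken at `1`.
  refine ⟨hZ_meas, aemeasurable_id, ProbabilityMeasure.tendsto_iff_tendsto_charFun.2 fun t => ?_⟩
  have hYm : AEMeasurable (fun x => inner ℝ (φ x) t) F₀ := hφ.1.aemeasurable.inner_const
  have hYL : MemLp (fun x => inner ℝ (φ x) t) 2 F₀ := hφ.inner_const t
  have hident : ∀ i, IdentDistrib (fun ω => inner ℝ (φ (X i ω)) t)
      (fun ω => inner ℝ (φ (X 0 ω)) t) μ μ := fun i => by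
    have : IdentDistrib (X i) (X 0) μ μ :=
      ⟨(hX_meas i).aemeasurable, (hX_meas 0).aemeasurable, by rw [hX_law, hX_law]⟩
    exact this.comp_of_aemeasurable (u := fun x => inner ℝ (φ x) t) (by rwa [hX_law i])
  have hmp : MeasurePreserving (X 0) μ F₀ := ⟨hX_meas 0, hX_law 0⟩
  have hindep : iIndepFun (fun i ω => inner ℝ (φ (X i ω)) t) μ :=
    hX_indep.comp₀ (fun _ x => inner ℝ (φ x) t) (fun i => (hX_meas i).aemeasurable)
      fun i => by rwa [hX_law i]
  have hvar : Var[fun ω => inner ℝ (φ (X 0 ω)) t; μ] = Var[fun x => inner ℝ (φ x) t; F₀] := by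
    rw [← hX_law 0, variance_map (by rwa [hX_law 0]) (hX_meas 0).aemeasurable]
    rfl
  have hmean : ∫ ω, inner ℝ (φ (X 0 ω)) t ∂μ = inner ℝ (∫ x, φ x ∂F₀) t := by
    rw [← integral_map (f := fun x => inner ℝ (φ x) t) (hX_meas 0).aemeasurable
      (by rw [hX_law 0]; exact hYL.1), hX_law 0]
    have := integral_inner (𝕜 := ℝ) (hφ.integrable (by norm_num)) t
    simp_rw [real_inner_comm t]
    exact this
  have h1 := tendsto_charFun_inv_sqrt_mul_sum_sub (hYL.comp_measurePreserving hmp) hindep hident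
  have hsum_meas : ∀ n : ℕ, AEMeasurable (fun ω => (√(n : ℝ))⁻¹ *
      (∑ k ∈ Finset.range n, inner ℝ (φ (X k ω)) t - n * inner ℝ (∫ x, φ x ∂F₀) t)) μ := fun n =>
    ((Finset.aemeasurable_fun_sum _ fun k _ => (hφX k).inner_const).sub_const _).const_mul _
  have hlim : charFun (multivariateGaussian 0 (covMatrix F₀ φ)) t =
      Complex.exp (-(Var[fun ω => inner ℝ (φ (X 0 ω)) t; μ] : ℂ) / 2) := by
    rw [charFun_multivariateGaussian (posSemidef_covMatrix hφ), dotProduct_covMatrix_mulVec hφ,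
      hvar]
    congr 1
    simp
    ring
  simp only [ProbabilityMeasure.coe_mk, Measure.map_id]
  rw [hlim]
  refine h1.congr fun n => ?_
  rw [hmean, charFun_apply, charFun_apply, integral_map (hZ_meas n) (by fun_prop),
    integral_map (hsum_meas n) (by fun_prop)]
  congr 1
  funext ω
  rw [inner_sqrt_smul_sampleMean_sub]
  simp

end CLT

end Gaussian

/-! ### Linearization of a bilinear estimating equation -/

/-- Applying `K` to the equation isolates `y`, with remainders at most a small multiple of `‖y‖ +
‖ζ‖`. The part in `‖y‖` is absorbed on the left, so `y` needs no prior rate. -/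
theorem eventually_norm_add_le_of_bilin_eq_zero {T V E E' : Type*} {L : Filter T}
    [NormedAddCommGroup V] [NormedSpace ℝ V] [NormedAddCommGroup E] [NormedSpace ℝ E]
    [NormedAddCommGroup E'] [NormedSpace ℝ E'] (B : V →L[ℝ] V →L[ℝ] E') (Γ : E →L[ℝ] V)
    (K : E' →L[ℝ] E) {c₀ : V} (hK : ∀ e, K (B c₀ (Γ e)) = e) {c ρ ζ : T → V} {y : T → E}
    (hc : Tendsto c L (𝓝 c₀)) (hρ : ∀ η > 0, ∀ᶠ t in L, ‖ρ t‖ ≤ η * ‖y t‖)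
    (heq : ∀ᶠ t in L, B (c t) (Γ (y t) + ρ t + ζ t) = 0) {η : ℝ} (hη : 0 < η) :
    ∀ᶠ t in L, ‖y t + K (B c₀ (ζ t))‖ ≤ η * ‖ζ t‖ := by
  set N : V →L[ℝ] E := K.comp (B c₀)
  have hN : ∀ z, K (B c₀ z) = N z := fun _ => rfl
  set a : ℝ := ‖K‖ * ‖B‖ * (‖Γ‖ + 1)
  set b : ℝ := ‖K‖ * ‖B‖ * (‖c₀‖ + 1)
  have ha : 0 ≤ a := by positivity
  have hb : 0 ≤ b := by positivity
  -- With `r = ‖y + Nζ‖`, the aim is `r ≤ q (‖y‖ + ‖ζ‖) ≤ q r + q (‖N‖ + 1) ‖ζ‖`. The bound `q ≤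
  -- 1/2` absorbs `q r`, and the other bound turns what is left into `η ‖ζ‖`.
  set q : ℝ := min (1 / 2) (η / (2 * (‖N‖ + 1)))
  have hq : 0 < q := by positivity
  have hq1 : q ≤ 1 / 2 := min_le_left _ _
  have hq2 : q * (2 * (‖N‖ + 1)) ≤ η := by
    have : q ≤ η / (2 * (‖N‖ + 1)) := min_le_right _ _
    rwa [le_div_iff₀ (by positivity)] at this
  have h1 := Metric.tendsto_nhds.1 hc (min 1 (q / (2 * (a + 1)))) (by positivity)
  filter_upwards [h1, hρ (q / (2 * (b + 1))) (by positivity), heq] with t ht1 ht2 ht3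
  rw [dist_eq_norm] at ht1
  have hcd : ‖c t - c₀‖ * a ≤ q / 2 := by
    have : ‖c t - c₀‖ ≤ q / (2 * (a + 1)) := (ht1.trans_le (min_le_right _ _)).le
    calc _ ≤ q / (2 * (a + 1)) * (a + 1) := by gcongr; linarith
      _ = q / 2 := by field_simp
  have hcn : ‖c t‖ ≤ ‖c₀‖ + 1 := by
    have := norm_add_le (c t - c₀) c₀
    rw [sub_add_cancel] at this
    linarith [ht1.trans_le (min_le_left _ _)]
  have hexp : y t + N (ζ t) = -(K (B (c t - c₀) (Γ (y t) + ζ t)) + K (B (c t) (ρ t))) := by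
    have h2 : K (B (c t) (Γ (y t) + ρ t + ζ t)) = 0 := by rw [ht3, map_zero]
    simp only [map_add, map_sub, sub_apply] at h2 ⊢
    rw [hK, hN]
    have := h2
    rw [← sub_eq_zero] at this ⊢
    rw [← this]
    abel
  have hKB : ∀ p z : V, ‖K (B p z)‖ ≤ ‖K‖ * ‖B‖ * ‖p‖ * ‖z‖ := fun p z => by
    refine (K.le_opNorm _).trans ?_
    have := B.le_opNorm₂ p z
    calc _ ≤ ‖K‖ * (‖B‖ * ‖p‖ * ‖z‖) := by gcongr
      _ = _ := by ring
  have hX1 : ‖K (B (c t - c₀) (Γ (y t) + ζ t))‖ ≤ q / 2 * (‖y t‖ + ‖ζ t‖) := by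
    have hs : ‖Γ (y t) + ζ t‖ ≤ (‖Γ‖ + 1) * (‖y t‖ + ‖ζ t‖) := by
      have := norm_add_le_of_le (Γ.le_opNorm (y t)) (le_refl ‖ζ t‖)
      nlinarith [norm_nonneg Γ, norm_nonneg (y t), norm_nonneg (ζ t)]
    calc _ ≤ ‖K‖ * ‖B‖ * ‖c t - c₀‖ * ‖Γ (y t) + ζ t‖ := hKB _ _
      _ ≤ ‖K‖ * ‖B‖ * ‖c t - c₀‖ * ((‖Γ‖ + 1) * (‖y t‖ + ‖ζ t‖)) := by gcongr
      _ = ‖c t - c₀‖ * a * (‖y t‖ + ‖ζ t‖) := by ring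
      _ ≤ _ := by gcongr
  have hX2 : ‖K (B (c t) (ρ t))‖ ≤ q / 2 * ‖y t‖ := by
    calc _ ≤ ‖K‖ * ‖B‖ * ‖c t‖ * ‖ρ t‖ := hKB _ _
      _ ≤ ‖K‖ * ‖B‖ * (‖c₀‖ + 1) * (q / (2 * (b + 1)) * ‖y t‖) := by gcongr
      _ = b * (q / (2 * (b + 1))) * ‖y t‖ := by ring
      _ ≤ (b + 1) * (q / (2 * (b + 1))) * ‖y t‖ := by gcongr; linarith
      _ = _ := by field_simp
  have hX : ‖y t + N (ζ t)‖ ≤ q * (‖y t‖ + ‖ζ t‖) := by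
    rw [hexp, norm_neg]
    have := norm_add_le_of_le hX1 hX2
    nlinarith [norm_nonneg (ζ t)]
  have hy : ‖y t‖ ≤ ‖y t + N (ζ t)‖ + ‖N‖ * ‖ζ t‖ := by
    have := norm_sub_le_of_le (le_refl ‖y t + N (ζ t)‖) (N.le_opNorm (ζ t))
    rwa [add_sub_cancel_right] at this
  rw [hN]
  have h3 : q * ‖y t + N (ζ t)‖ ≤ 1 / 2 * ‖y t + N (ζ t)‖ := by gcongr
  have h4 : q * ‖y t‖ ≤ q * (‖y t + N (ζ t)‖ + ‖N‖ * ‖ζ t‖) := by gcongr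
  have h5 : q * (2 * (‖N‖ + 1)) * ‖ζ t‖ ≤ η * ‖ζ t‖ := by gcongr
  nlinarith

/-! ### The matrix `A` as a bilinear map -/

section AugBilin

variable {m p : ℕ} (W : Matrix (Fin m) (Fin m) ℝ)

/-- The block of the moments in an augmented moment vector. -/
def momentBlock (a : EuclideanSpace ℝ (Fin m ⊕ Fin m × Fin p)) : EuclideanSpace ℝ (Fin m) :=
  WithLp.toLp 2 fun j => a (Sum.inl j)

/-- The block of the derivatives in an augmented moment vector. -/
def derivBlock (a : EuclideanSpace ℝ (Fin m ⊕ Fin m × Fin p)) : Matrix (Fin m) (Fin p) ℝ :=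
  Matrix.of fun j k => a (Sum.inr (j, k))

/-- `a ↦ [M'W, v'W ⊗ I_p]`, where `v` and `M` are the two blocks of `a`, as a bilinear map. -/
noncomputable def augBilin :
    EuclideanSpace ℝ (Fin m ⊕ Fin m × Fin p) →L[ℝ]
      EuclideanSpace ℝ (Fin m ⊕ Fin m × Fin p) →L[ℝ] EuclideanSpace ℝ (Fin p) :=
  LinearMap.toContinuousLinearMap
    { toFun := fun a => LinearMap.toContinuousLinearMap
        (Matrix.toEuclideanLin (augWeight W (derivBlock a) (momentBlock a)))
      map_add' := fun a b => by
        rw [← map_add, ← map_add]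
        congr 2
        ext k (j | ⟨j, l⟩)
        · simp [augWeight, derivBlock, Matrix.mul_apply, add_mul, Finset.sum_add_distrib]
        · simp [augWeight, momentBlock, Matrix.vecMul, dotProduct, add_mul, Finset.sum_add_distrib]
      map_smul' := fun r a => by
        rw [RingHom.id_apply, ← map_smul, ← map_smul]
        congr 2
        ext k (j | ⟨j, l⟩)
        · simp [augWeight, derivBlock, Matrix.mul_apply, Finset.mul_sum, mul_assoc]
        · simp [augWeight, momentBlock, Matrix.vecMul, dotProduct, ← Finset.mul_sum, mul_assoc] }

theorem augBilin_apply_eq (a : EuclideanSpace ℝ (Fin m ⊕ Fin m × Fin p)) :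
    augBilin W a = LinearMap.toContinuousLinearMap
      (Matrix.toEuclideanLin (augWeight W (derivBlock a) (momentBlock a))) := rfl

theorem augBilin_apply_apply_eq (a b : EuclideanSpace ℝ (Fin m ⊕ Fin m × Fin p)) :
    augBilin W a b = WithLp.toLp 2 (augWeight W (derivBlock a) (momentBlock a) *ᵥ b.ofLp) := rfl

/-- The two summands exchange their roles under `a ↔ b`. The formula also exhibits the product rule
for `v'Wv`. -/
theorem augBilin_apply_apply (a b : EuclideanSpace ℝ (Fin m ⊕ Fin m × Fin p)) (k : Fin p) :
    augBilin W a b k =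
      (fun j => a (Sum.inr (j, k))) ⬝ᵥ (W *ᵥ fun j => b (Sum.inl j)) +
        (fun j => a (Sum.inl j)) ⬝ᵥ (W *ᵥ fun j => b (Sum.inr (j, k))) := by
  rw [augBilin_apply_apply_eq]
  simp only [augWeight]
  rw [Matrix.fromCols_mulVec]
  simp only [Pi.add_apply]
  congr 1
  · rw [← Matrix.mulVec_mulVec]
    rfl
  · rw [Matrix.dotProduct_mulVec]
    simp [Matrix.mulVec, dotProduct, Fintype.sum_prod_type, Matrix.one_apply, momentBlock]

theorem dotProduct_mulVec_comm {W : Matrix (Fin m) (Fin m) ℝ} (hW : W.IsSymm) (v w : Fin m → ℝ) :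
    v ⬝ᵥ W *ᵥ w = w ⬝ᵥ W *ᵥ v := by
  rw [Matrix.dotProduct_mulVec, dotProduct_comm, ← Matrix.mulVec_transpose, hW.eq]

theorem augBilin_comm {W : Matrix (Fin m) (Fin m) ℝ} (hW : W.IsSymm)
    (a b : EuclideanSpace ℝ (Fin m ⊕ Fin m × Fin p)) : augBilin W a b = augBilin W b a := by
  ext k
  rw [augBilin_apply_apply, augBilin_apply_apply, dotProduct_mulVec_comm hW, add_comm,
    dotProduct_mulVec_comm hW]

end AugBilin

/-! ### Smooth moment functions -/

theorem memLp_two_of_lintegral_enorm_sq {𝒳 W : Type*} [MeasurableSpace 𝒳] {F₀ : Measure 𝒳}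
    [NormedAddCommGroup W] {f : 𝒳 → W} (hf : AEStronglyMeasurable f F₀)
    (hlt : ∫⁻ x, ‖f x‖ₑ ^ 2 ∂F₀ < ∞) : MemLp f 2 F₀ := by
  refine ⟨hf, (eLpNorm_lt_top_iff_lintegral_rpow_enorm_lt_top (by norm_num) (by norm_num)).2 ?_⟩
  simpa using hlt

theorem jacobian_eq_toMatrix {a b : Type*} [Fintype a] [DecidableEq a] [Fintype b] [DecidableEq b]
    (f : EuclideanSpace ℝ a → EuclideanSpace ℝ b) (θ : EuclideanSpace ℝ a) :
    (Matrix.toEuclideanLin (jacobian f θ)).toContinuousLinearMap = fderiv ℝ f θ := by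
  refine ContinuousLinearMap.coe_injective ((EuclideanSpace.basisFun a ℝ).toBasis.ext fun k => ?_)
  ext j
  simp [jacobian, Matrix.toLpLin_apply]

/-- Matrices carry the `ℓ²` operator norm here, so envelope conditions on `G` and `F` are conditions
on Fréchet derivatives. -/
theorem norm_jacobian {a b : Type*} [Fintype a] [DecidableEq a] [Fintype b] [DecidableEq b]
    (f : EuclideanSpace ℝ a → EuclideanSpace ℝ b) (θ : EuclideanSpace ℝ a) :
    ‖jacobian f θ‖ = ‖fderiv ℝ f θ‖ := by
  rw [← jacobian_eq_toMatrix]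
  rfl

theorem enorm_jacobian {a b : Type*} [Fintype a] [DecidableEq a] [Fintype b] [DecidableEq b]
    (f : EuclideanSpace ℝ a → EuclideanSpace ℝ b) (θ : EuclideanSpace ℝ a) :
    ‖jacobian f θ‖ₑ = ‖fderiv ℝ f θ‖ₑ := by
  rw [← ofReal_norm, ← ofReal_norm, norm_jacobian]

section Smooth

variable {m p : ℕ}

/-- The linear map that sends a derivative to the vector of its partial derivatives. -/
noncomputable def vecDeriv (m p : ℕ) :
    (EuclideanSpace ℝ (Fin p) →L[ℝ] EuclideanSpace ℝ (Fin m)) →L[ℝ]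
      EuclideanSpace ℝ (Fin m × Fin p) :=
  LinearMap.toContinuousLinearMap
    { toFun := fun φ => WithLp.toLp 2 fun q => φ (EuclideanSpace.single q.2 1) q.1
      map_add' := fun φ φ' => by ext; simp
      map_smul' := fun r φ => by ext; simp }

/-- The linear map that stacks the moments and their derivatives. -/
noncomputable def stack (m p : ℕ) :
    EuclideanSpace ℝ (Fin m) × EuclideanSpace ℝ (Fin m × Fin p) →L[ℝ]
      EuclideanSpace ℝ (Fin m ⊕ Fin m × Fin p) :=
  LinearMap.toContinuousLinearMap
    { toFun := fun q => WithLp.toLp 2 (Sum.elim q.1 q.2)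
      map_add' := fun q q' => by ext (j | j) <;> simp
      map_smul' := fun r q => by ext (j | j) <;> simp }

variable {𝒳 : Type*} (g : 𝒳 → EuclideanSpace ℝ (Fin p) → EuclideanSpace ℝ (Fin m))

theorem vecGT_eq (x : 𝒳) (θ : EuclideanSpace ℝ (Fin p)) :
    vecGT g x θ = vecDeriv m p (fderiv ℝ (g x) θ) := rfl

theorem psi_eq (x : 𝒳) (θ : EuclideanSpace ℝ (Fin p)) :
    psi g x θ = stack m p (g x θ, vecGT g x θ) := rfl

variable {g}

theorem contDiffAt_vecGT {x : 𝒳} {θ : EuclideanSpace ℝ (Fin p)} (h : ContDiffAt ℝ 2 (g x) θ) :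
    ContDiffAt ℝ 1 (vecGT g x) θ :=
  (vecDeriv m p).contDiff.contDiffAt.comp θ (h.fderiv_right (m := 1) (by norm_num))

theorem contDiffAt_psi {x : 𝒳} {θ : EuclideanSpace ℝ (Fin p)} (h : ContDiffAt ℝ 2 (g x) θ) :
    ContDiffAt ℝ 1 (psi g x) θ :=
  (stack m p).contDiff.contDiffAt.comp θ ((h.of_le (by norm_num)).prodMk (contDiffAt_vecGT h))

theorem enorm_psi_le (x : 𝒳) (θ : EuclideanSpace ℝ (Fin p)) :
    ‖psi g x θ‖ₑ ≤ ‖stack m p‖ₑ * (‖g x θ‖ₑ + ‖vecDeriv m p‖ₑ * ‖G g x θ‖ₑ) := by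
  rw [psi_eq, vecGT_eq]
  refine ((stack m p).le_opENorm _).trans ?_
  gcongr
  rw [G, enorm_jacobian]
  simp only [← ofReal_norm]
  rw [← ENNReal.ofReal_mul (by positivity), ← ENNReal.ofReal_add (by positivity) (by positivity)]
  refine ENNReal.ofReal_le_ofReal ?_
  rw [Prod.norm_def]
  refine (max_le_add_of_nonneg (norm_nonneg _) (norm_nonneg _)).trans ?_
  gcongr
  exact (vecDeriv m p).le_opNorm _

theorem enorm_fderiv_psi_le {x : 𝒳} {θ : EuclideanSpace ℝ (Fin p)}
    (h : ContDiffAt ℝ 2 (g x) θ) :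
    ‖fderiv ℝ (psi g x) θ‖ₑ ≤ ‖stack m p‖ₑ * (‖G g x θ‖ₑ + ‖F g x θ‖ₑ) := by
  have hd : HasFDerivAt (psi g x)
      ((stack m p).comp ((fderiv ℝ (g x) θ).prod (fderiv ℝ (vecGT g x) θ))) θ :=
    (stack m p).hasFDerivAt.comp θ
      ((h.differentiableAt (by norm_num)).hasFDerivAt.prodMk
        ((contDiffAt_vecGT h).differentiableAt (by norm_num)).hasFDerivAt)
  rw [hd.fderiv, G, F, enorm_jacobian, enorm_jacobian]
  simp only [← ofReal_norm]
  rw [← ENNReal.ofReal_add (by positivity) (by positivity), ← ENNReal.ofReal_mul (by positivity)]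
  refine ENNReal.ofReal_le_ofReal ((ContinuousLinearMap.opNorm_comp_le _ _).trans ?_)
  gcongr
  rw [ContinuousLinearMap.opNorm_prod, Prod.norm_def]
  exact max_le (le_add_of_nonneg_right (norm_nonneg _)) (le_add_of_nonneg_left (norm_nonneg _))

/-- Moment functions that are measurable, twice continuously differentiable on `Θ`, and whose values
and derivatives up to order two have integrable envelopes on `Θ`. -/
structure IsSmoothMoment [MeasurableSpace 𝒳] (F₀ : Measure 𝒳)
    (g : 𝒳 → EuclideanSpace ℝ (Fin p) → EuclideanSpace ℝ (Fin m))
    (Θ : Set (EuclideanSpace ℝ (Fin p))) : Prop where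
  measurable : ∀ θ, Measurable fun x => g x θ
  contDiffAt : ∀ᵐ x ∂F₀, ∀ θ ∈ Θ, ContDiffAt ℝ 2 (g x) θ
  lintegral_g : ∫⁻ x, ⨆ θ ∈ Θ, ‖g x θ‖ₑ ∂F₀ < ∞
  lintegral_G : ∫⁻ x, ⨆ θ ∈ Θ, ‖G g x θ‖ₑ ∂F₀ < ∞
  lintegral_F : ∫⁻ x, ⨆ θ ∈ Θ, ‖F g x θ‖ₑ ∂F₀ < ∞

namespace IsSmoothMoment

variable [MeasurableSpace 𝒳] {F₀ : Measure 𝒳} {Θ : Set (EuclideanSpace ℝ (Fin p))}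
  (H : IsSmoothMoment F₀ g Θ)
include H

theorem aestronglyMeasurable_fderiv {θ : EuclideanSpace ℝ (Fin p)} (hθ : θ ∈ Θ) :
    AEStronglyMeasurable (fun x => fderiv ℝ (g x) θ) F₀ :=
  aestronglyMeasurable_clm_of_apply fun _ => aestronglyMeasurable_fderiv_apply
    (Eventually.of_forall fun θ => (H.measurable θ).aestronglyMeasurable)
    (H.contDiffAt.mono fun _ hx => (hx θ hθ).differentiableAt (by norm_num)) _

theorem aestronglyMeasurable_psi {θ : EuclideanSpace ℝ (Fin p)} (hθ : θ ∈ Θ) :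
    AEStronglyMeasurable (fun x => psi g x θ) F₀ :=
  (stack m p).continuous.comp_aestronglyMeasurable
    ((H.measurable θ).aestronglyMeasurable.prodMk
      ((vecDeriv m p).continuous.comp_aestronglyMeasurable (H.aestronglyMeasurable_fderiv hθ)))

theorem aemeasurable_iSup_G : AEMeasurable (fun x => ⨆ θ ∈ Θ, ‖G g x θ‖ₑ) F₀ := by
  simp only [G, enorm_jacobian]
  refine aemeasurable_biSup_of_continuousOn
    (fun θ hθ => (H.aestronglyMeasurable_fderiv hθ).enorm) (H.contDiffAt.mono fun x hx θ hθ => ?_)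
  exact ((hx θ hθ).fderiv_right (m := 1) (by norm_num)).continuousAt.continuousWithinAt.enorm

theorem isDominatedOn_psi : IsDominatedOn F₀ Θ (psi g) where
  aestronglyMeasurable θ hθ := H.aestronglyMeasurable_psi hθ
  continuousOn := H.contDiffAt.mono fun x hx θ hθ =>
    (contDiffAt_psi (hx θ hθ)).continuousAt.continuousWithinAt
  lintegral_iSup_lt_top := by
    calc ∫⁻ x, ⨆ θ ∈ Θ, ‖psi g x θ‖ₑ ∂F₀
        ≤ ∫⁻ x, ‖stack m p‖ₑ * (‖vecDeriv m p‖ₑ * (⨆ θ ∈ Θ, ‖G g x θ‖ₑ) + ⨆ θ ∈ Θ, ‖g x θ‖ₑ) ∂F₀ := by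
          refine lintegral_mono fun x => iSup₂_le fun θ hθ => (enorm_psi_le x θ).trans ?_
          -- The term in `G` is put first because additivity of the integral is used with the
          -- measurability of that term.
          rw [add_comm]
          gcongr
          · exact le_iSup₂_of_le θ hθ le_rfl
          · exact le_iSup₂_of_le θ hθ le_rfl
      _ < ∞ := by
          rw [lintegral_const_mul' _ _ enorm_ne_top,
            lintegral_add_left' (H.aemeasurable_iSup_G.const_mul _),
            lintegral_const_mul' _ _ enorm_ne_top]
          exact ENNReal.mul_lt_top enorm_lt_top (ENNReal.add_lt_top.2
            ⟨ENNReal.mul_lt_top enorm_lt_top H.lintegral_G, H.lintegral_g⟩)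

/-- Restricted to the interior because `ψ` is known to be measurable only at points of `Θ`, and
difference quotients need a whole neighbourhood. -/
theorem isDominatedOn_fderiv_psi :
    IsDominatedOn F₀ (interior Θ) fun x θ => fderiv ℝ (psi g x) θ where
  aestronglyMeasurable θ hθ := aestronglyMeasurable_clm_of_apply fun _ =>
    aestronglyMeasurable_fderiv_apply
      ((eventually_mem_nhds_iff.2 (mem_interior_iff_mem_nhds.1 hθ)).mono fun _ hθ' =>
        H.aestronglyMeasurable_psi (mem_of_mem_nhds hθ'))
      (H.contDiffAt.mono fun _ hx =>
        (contDiffAt_psi (hx θ (interior_subset hθ))).differentiableAt (by norm_num)) _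
  continuousOn := H.contDiffAt.mono fun x hx θ hθ =>
    ((contDiffAt_psi (hx θ (interior_subset hθ))).fderiv_right
      (m := 0) (by norm_num)).continuousAt.continuousWithinAt
  lintegral_iSup_lt_top := by
    calc ∫⁻ x, ⨆ θ ∈ interior Θ, ‖fderiv ℝ (psi g x) θ‖ₑ ∂F₀
        ≤ ∫⁻ x, ‖stack m p‖ₑ * ((⨆ θ ∈ Θ, ‖G g x θ‖ₑ) + ⨆ θ ∈ Θ, ‖F g x θ‖ₑ) ∂F₀ := by
          refine lintegral_mono_ae (H.contDiffAt.mono fun x hx => iSup₂_le fun θ hθ => ?_)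
          have hθ' := interior_subset hθ
          refine (enorm_fderiv_psi_le (hx θ hθ')).trans ?_
          gcongr
          · exact le_iSup₂_of_le θ hθ' le_rfl
          · exact le_iSup₂_of_le θ hθ' le_rfl
      _ < ∞ := by
          rw [lintegral_const_mul' _ _ enorm_ne_top, lintegral_add_left' H.aemeasurable_iSup_G]
          exact ENNReal.mul_lt_top enorm_lt_top
            (ENNReal.add_lt_top.2 ⟨H.lintegral_G, H.lintegral_F⟩)

theorem memLp_psi {θ : EuclideanSpace ℝ (Fin p)} (hθ : θ ∈ Θ)
    (hg : ∫⁻ x, ‖g x θ‖ₑ ^ 2 ∂F₀ < ∞) (hG : ∫⁻ x, ‖G g x θ‖ₑ ^ 2 ∂F₀ < ∞) :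
    MemLp (fun x => psi g x θ) 2 F₀ := by
  have hg' : MemLp (fun x => g x θ) 2 F₀ :=
    memLp_two_of_lintegral_enorm_sq (H.measurable θ).aestronglyMeasurable hg
  have hG' : MemLp (fun x => fderiv ℝ (g x) θ) 2 F₀ :=
    memLp_two_of_lintegral_enorm_sq (H.aestronglyMeasurable_fderiv hθ)
      (by simpa only [G, enorm_jacobian] using hG)
  have hv : MemLp (fun x => vecGT g x θ) 2 F₀ := (vecDeriv m p).comp_memLp' hG'
  have hpair : MemLp (fun x => (g x θ, vecGT g x θ)) 2 F₀ :=
    memLp_prod_iff.2 ⟨hg', hv⟩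
  exact (stack m p).comp_memLp' hpair

theorem psiPop_inl {θ : EuclideanSpace ℝ (Fin p)} (hθ : θ ∈ Θ) :
    momentBlock (psiPop F₀ g θ) = gPop F₀ g θ := by
  let φ : EuclideanSpace ℝ (Fin m ⊕ Fin m × Fin p) →L[ℝ] EuclideanSpace ℝ (Fin m) :=
    LinearMap.toContinuousLinearMap
      { toFun := momentBlock, map_add' := fun _ _ => rfl, map_smul' := fun _ _ => rfl }
  exact (φ.integral_comp_comm (H.isDominatedOn_psi.integrable hθ)).symm

theorem psiPop_inr {θ : EuclideanSpace ℝ (Fin p)} (hθ : θ ∈ Θ) :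
    derivBlock (psiPop F₀ g θ) = GPop F₀ g θ := by
  ext j k
  exact ((EuclideanSpace.proj (𝕜 := ℝ) (Sum.inr (j, k))).integral_comp_comm
    (H.isDominatedOn_psi.integrable hθ)).symm

theorem augBilin_psiPop (W : Matrix (Fin m) (Fin m) ℝ) {θ : EuclideanSpace ℝ (Fin p)}
    (hθ : θ ∈ Θ) : augBilin W (psiPop F₀ g θ) =
      (Matrix.toEuclideanLin (APop F₀ g W θ)).toContinuousLinearMap := by
  rw [augBilin_apply_eq, H.psiPop_inl hθ, H.psiPop_inr hθ, APop]

theorem toEuclideanLin_GammaPop {θ : EuclideanSpace ℝ (Fin p)} (hθ : θ ∈ interior Θ) :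
    (Matrix.toEuclideanLin (GammaPop F₀ g θ)).toContinuousLinearMap =
      ∫ x, fderiv ℝ (psi g x) θ ∂F₀ := by
  refine ContinuousLinearMap.coe_injective
    ((EuclideanSpace.basisFun (Fin p) ℝ).toBasis.ext fun k => ?_)
  ext a
  have hint := H.isDominatedOn_fderiv_psi.integrable hθ
  have h := ((EuclideanSpace.proj (𝕜 := ℝ) a).comp
    (ContinuousLinearMap.apply ℝ _ (EuclideanSpace.single k 1))).integral_comp_comm hint
  simp only [ContinuousLinearMap.comp_apply, ContinuousLinearMap.apply_apply] at h
  simp [Matrix.toLpLin_apply, GammaPop, jacobian]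
  exact h

end IsSmoothMoment

end Smooth

/-! ### The first-order condition -/

section FirstOrder

variable {𝒳 : Type*} {m p n : ℕ} {g : 𝒳 → EuclideanSpace ℝ (Fin p) → EuclideanSpace ℝ (Fin m)}

theorem momentBlock_psiSample (x : Fin n → 𝒳) (θ : EuclideanSpace ℝ (Fin p)) :
    momentBlock (psiSample g x θ) = gSample g x θ := by
  ext j
  simp [momentBlock, psiSample, gSample, psi]

theorem derivBlock_psiSample (x : Fin n → 𝒳) (θ : EuclideanSpace ℝ (Fin p)) :
    derivBlock (psiSample g x θ) = GSample g x θ := by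
  ext j k
  simp [derivBlock, psiSample, GSample, psi, vecGT, Matrix.vec, Matrix.sum_apply]

theorem augBilin_psiSample (W : Matrix (Fin m) (Fin m) ℝ) (x : Fin n → 𝒳)
    (θ : EuclideanSpace ℝ (Fin p)) (b : EuclideanSpace ℝ (Fin m ⊕ Fin m × Fin p)) :
    augBilin W (psiSample g x θ) b = WithLp.toLp 2 (ASample g W x θ *ᵥ b.ofLp) := by
  rw [augBilin_apply_apply_eq, momentBlock_psiSample, derivBlock_psiSample, ASample]

theorem hasFDerivAt_gSample {x : Fin n → 𝒳} {θ : EuclideanSpace ℝ (Fin p)}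
    (h : ∀ i, DifferentiableAt ℝ (g (x i)) θ) :
    HasFDerivAt (gSample g x) ((n : ℝ)⁻¹ • ∑ i, fderiv ℝ (g (x i)) θ) θ := by
  have hsum : HasFDerivAt (fun θ => ∑ i, g (x i) θ) (∑ i, fderiv ℝ (g (x i)) θ) θ :=
    HasFDerivAt.fun_sum fun i _ => (h i).hasFDerivAt
  exact hsum.const_smul (n : ℝ)⁻¹

/-- A local minimizer of the GMM criterion solves the first-order condition. -/
theorem augBilin_psiSample_self_eq_zero {W : Matrix (Fin m) (Fin m) ℝ} {x : Fin n → 𝒳} {θ : EuclideanSpace ℝ (Fin p)} (h : ∀ i, DifferentiableAt ℝ (g (x i)) θ)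
    (hmin : IsLocalMin (fun θ => quad W (gSample g x θ)) θ) :
    augBilin W (psiSample g x θ) (psiSample g x θ) = 0 := by
  set w : EuclideanSpace ℝ (Fin m) →L[ℝ] EuclideanSpace ℝ (Fin m) :=
    (Matrix.toEuclideanLin W).toContinuousLinearMap with hw
  have hinner : ∀ v v' : EuclideanSpace ℝ (Fin m), inner ℝ v (w v') = v.ofLp ⬝ᵥ W *ᵥ v'.ofLp :=
    fun v v' => by
      rw [EuclideanSpace.inner_eq_star_dotProduct, dotProduct_comm]
      simp [hw, Matrix.toLpLin_apply]
  -- The product rule for `v'Wv` in the direction of the `k`-th coordinate gives exactly the two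
  -- terms of `augBilin W ψ_n ψ_n`, without symmetry of `W`.
  have hg := hasFDerivAt_gSample h
  have hq : HasFDerivAt (fun θ => inner ℝ (gSample g x θ) (w (gSample g x θ))) _ θ :=
    hg.inner ℝ (w.hasFDerivAt.comp θ hg)
  simp only [hinner] at hq
  have h0 := hmin.hasFDerivAt_eq_zero hq
  ext k
  have hk := congrArg (fun φ => φ (EuclideanSpace.single k 1)) h0
  simp only [ContinuousLinearMap.comp_apply, ContinuousLinearMap.prod_apply, fderivInnerCLM_apply,
    zero_apply, hinner] at hk
  have hcol : (((n : ℝ)⁻¹ • ∑ i, fderiv ℝ (g (x i)) θ) (EuclideanSpace.single k 1)).ofLp =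
      fun j => psiSample g x θ (Sum.inr (j, k)) := by
    funext j
    simp [psiSample, psi, vecGT, Matrix.vec, G, jacobian, sum_apply]
  have hfst : (gSample g x θ).ofLp = fun j => psiSample g x θ (Sum.inl j) :=
    congrArg WithLp.ofLp (momentBlock_psiSample x θ).symm
  rw [hcol, hfst] at hk
  rw [augBilin_apply_apply, add_comm]
  exact hk

end FirstOrder

/-! ### Consistency and linearization of estimators -/

section Estimators

variable {𝒳 T : Type*} [MeasurableSpace 𝒳] {m p : ℕ} {F₀ : Measure 𝒳}
  {g : 𝒳 → EuclideanSpace ℝ (Fin p) → EuclideanSpace ℝ (Fin m)}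
  {Θ : Set (EuclideanSpace ℝ (Fin p))} {L : Filter T} {n : T → ℕ} {x : (t : T) → Fin (n t) → 𝒳}

theorem IsLLN.mono {L' : Filter T} (HL : IsLLN F₀ L n x) (h : L' ≤ L) : IsLLN F₀ L' n x where
  eventually_ae P hP := h (HL.eventually_ae P hP)
  tendsto_real f hf := (HL.tendsto_real f hf).mono_left h

theorem IsSmoothMoment.tendsto_psiSample (H : IsSmoothMoment F₀ g Θ) (HL : IsLLN F₀ L n x)
    (hΘ : IsCompact Θ) {u : T → EuclideanSpace ℝ (Fin p)} {θ : EuclideanSpace ℝ (Fin p)}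
    (hθ : θ ∈ Θ) (huΘ : ∀ᶠ t in L, u t ∈ Θ) (hu : Tendsto u L (𝓝 θ)) :
    Tendsto (fun t => psiSample g (x t) (u t)) L (𝓝 (psiPop F₀ g θ)) := by
  have h1 := HL.tendsto_sampleMean_comp H.isDominatedOn_psi hΘ huΘ
  have h2 : Tendsto (fun t => ∫ y, psi g y (u t) ∂F₀) L (𝓝 (psiPop F₀ g θ)) :=
    (H.isDominatedOn_psi.continuousOn_integral θ hθ).tendsto.comp
      (tendsto_nhdsWithin_iff.2 ⟨hu, huΘ⟩)
  have h3 := h1.add h2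
  simp only [sub_add_cancel, zero_add] at h3
  exact h3

/-- An estimator in a compact set is consistent if every limit point of it is `θ₀`. -/
theorem IsSmoothMoment.tendsto_of_forall_ultrafilter (H : IsSmoothMoment F₀ g Θ)
    (HL : IsLLN F₀ L n x) (hΘ : IsCompact Θ) {u : T → EuclideanSpace ℝ (Fin p)}
    {θ₀ : EuclideanSpace ℝ (Fin p)} (huΘ : ∀ᶠ t in L, u t ∈ Θ)
    (h : ∀ θ ∈ Θ, ∀ U : Ultrafilter T, ↑U ≤ L →
      Tendsto (fun t => psiSample g (x t) (u t)) U (𝓝 (psiPop F₀ g θ)) → θ = θ₀) :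
    Tendsto u L (𝓝 θ₀) := by
  -- A cluster point is a limit along a finer ultrafilter, which inherits the law of large numbers;
  -- hence `ψ_n(u)` converges there to the population value at that point.
  refine hΘ.tendsto_nhds_of_unique_mapClusterPt huΘ fun θ hθ hcl => ?_
  obtain ⟨U, hU, hUu⟩ := mapClusterPt_iff_ultrafilter.1 hcl
  exact h θ hθ U hU (H.tendsto_psiSample (HL.mono hU) hΘ hθ (hU huΘ) hUu)

/-- Linearization of the difference of two consistent estimators. -/
theorem IsSmoothMoment.eventually_norm_sub_add_le (H : IsSmoothMoment F₀ g Θ)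
    (HL : IsLLN F₀ L n x) {W : Matrix (Fin m) (Fin m) ℝ} {θ₀ : EuclideanSpace ℝ (Fin p)}
    (hθ₀ : θ₀ ∈ interior Θ) (hrank : IsUnit (APop F₀ g W θ₀ * GammaPop F₀ g θ₀).det)
    {u v : T → EuclideanSpace ℝ (Fin p)} (hu : Tendsto u L (𝓝 θ₀)) (hv : Tendsto v L (𝓝 θ₀))
    {c ζ : T → EuclideanSpace ℝ (Fin m ⊕ Fin m × Fin p)}
    (hc : Tendsto c L (𝓝 (psiPop F₀ g θ₀)))
    (heq : ∀ᶠ t in L, augBilin W (c t)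
      (psiSample g (x t) (u t) - psiSample g (x t) (v t) + ζ t) = 0) {η : ℝ} (hη : 0 < η) :
    ∀ᶠ t in L, ‖(u t - v t) - (Matrix.toEuclideanLin (-((APop F₀ g W θ₀ * GammaPop F₀ g θ₀)⁻¹ *
      APop F₀ g W θ₀))).toContinuousLinearMap (ζ t)‖ ≤ η * ‖ζ t‖ := by
  set Γ := ∫ y, fderiv ℝ (psi g y) θ₀ ∂F₀ with hΓ
  set B := APop F₀ g W θ₀ * GammaPop F₀ g θ₀ with hB
  have hA := H.augBilin_psiPop W (interior_subset hθ₀)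
  have hK : ∀ e, (Matrix.toEuclideanLin B⁻¹).toContinuousLinearMap
      (augBilin W (psiPop F₀ g θ₀) (Γ e)) = e := fun e => by
    rw [hA, hΓ, ← H.toEuclideanLin_GammaPop hθ₀]
    simp only [LinearMap.coe_toContinuousLinearMap', Matrix.toLpLin_apply, Matrix.mulVec_mulVec]
    rw [← hB, Matrix.nonsing_inv_mul _ hrank, Matrix.one_mulVec]
  have hρ : ∀ η > 0, ∀ᶠ t in L, ‖psiSample g (x t) (u t) - psiSample g (x t) (v t) -
      Γ (u t - v t)‖ ≤ η * ‖u t - v t‖ := fun η hη => by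
    obtain ⟨δ, hδ, hδt⟩ := HL.eventually_norm_sampleMean_sub_sub_le
      (isOpen_interior.mem_nhds hθ₀) (h := psi g)
      (H.contDiffAt.mono fun y hy θ hθ =>
        (contDiffAt_psi (hy θ (interior_subset hθ))).differentiableAt (by norm_num))
      H.isDominatedOn_fderiv_psi hη
    filter_upwards [hδt, hu (Metric.ball_mem_nhds θ₀ hδ), hv (Metric.ball_mem_nhds θ₀ hδ)]
      with t ht htu htv
    exact ht _ htu _ htv
  have := eventually_norm_add_le_of_bilin_eq_zero (augBilin W) Γ
    (Matrix.toEuclideanLin B⁻¹).toContinuousLinearMap hK hc hρ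
    (heq.mono fun t ht => by rwa [add_sub_cancel]) hη
  refine this.mono fun t ht => ?_
  rw [hA] at ht
  simpa [Matrix.toLpLin_apply, Matrix.neg_mulVec] using ht

end Estimators

/-! ### The limit variance -/

section Variance

variable {𝒳 : Type*} [MeasurableSpace 𝒳] {m p : ℕ} {F₀ : Measure 𝒳} [IsProbabilityMeasure F₀]
  {g : 𝒳 → EuclideanSpace ℝ (Fin p) → EuclideanSpace ℝ (Fin m)} {θ : EuclideanSpace ℝ (Fin p)}

/-- The sign of the linearization occurs twice in the sandwich and cancels. -/
theorem map_multivariateGaussian_SigmaPop (W : Matrix (Fin m) (Fin m) ℝ)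
    (hψ : MemLp (fun x => psi g x θ) 2 F₀) :
    (multivariateGaussian 0 (SigmaPop F₀ g θ)).map
        (Matrix.toEuclideanLin (-((APop F₀ g W θ * GammaPop F₀ g θ)⁻¹ *
          APop F₀ g W θ))).toContinuousLinearMap =
      multivariateGaussian 0 (VGMM F₀ g W θ) := by
  have hS : (SigmaPop F₀ g θ).PosSemidef := posSemidef_covMatrix hψ
  rw [map_multivariateGaussian hS, VGMM]
  congr 1
  simp [Matrix.transpose_mul, Matrix.transpose_nonsing_inv, Matrix.mul_assoc]

end Variance

theorem norm_smul_sub_map_smul_le {V E : Type*} [NormedAddCommGroup V] [NormedSpace ℝ V]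
    [NormedAddCommGroup E] [NormedSpace ℝ E] (M : V →L[ℝ] E) {y : E} {ζ : V} {η : ℝ}
    (h : ‖y - M ζ‖ ≤ η * ‖ζ‖) {r : ℝ} (hr : 0 ≤ r) : ‖r • y - M (r • ζ)‖ ≤ η * ‖r • ζ‖ := by
  rw [map_smul, ← smul_sub, norm_smul, norm_smul, Real.norm_of_nonneg hr]
  calc _ ≤ r * (η * ‖ζ‖) := by gcongr
    _ = _ := by ring

/-! ### Consistency of the two estimators -/

variable {𝒳 T : Type*} [MeasurableSpace 𝒳] {m p : ℕ} {F₀ : Measure 𝒳}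
  {g : 𝒳 → EuclideanSpace ℝ (Fin p) → EuclideanSpace ℝ (Fin m)}
  {Θ : Set (EuclideanSpace ℝ (Fin p))} {L : Filter T} {n : T → ℕ} {x : (t : T) → Fin (n t) → 𝒳}

/-- Consistency of the GMM estimator. -/
theorem IsSmoothMoment.tendsto_isMinOn_quad (H : IsSmoothMoment F₀ g Θ) (HL : IsLLN F₀ L n x)
    (hΘ : IsCompact Θ) {W : Matrix (Fin m) (Fin m) ℝ} {θ₀ : EuclideanSpace ℝ (Fin p)}
    (hθ₀ : θ₀ ∈ Θ) (hmin : ∀ θ ∈ Θ, θ ≠ θ₀ → quad W (gPop F₀ g θ₀) < quad W (gPop F₀ g θ))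
    {u : T → EuclideanSpace ℝ (Fin p)}
    (hu : ∀ᶠ t in L, u t ∈ Θ ∧ IsMinOn (fun θ => quad W (gSample g (x t) θ)) Θ (u t)) :
    Tendsto u L (𝓝 θ₀) := by
  refine H.tendsto_of_forall_ultrafilter HL hΘ (hu.mono fun _ h => h.1) fun θ hθ U hU hlim => ?_
  by_contra hne
  have hq : Continuous fun a : EuclideanSpace ℝ (Fin m ⊕ Fin m × Fin p) =>
      quad W (momentBlock a) := by
    unfold quad momentBlock dotProduct Matrix.mulVec dotProduct
    fun_prop
  have h1 := (hq.tendsto _).comp hlim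
  have h2 := (hq.tendsto _).comp (H.tendsto_psiSample (HL.mono hU) hΘ hθ₀
    (Eventually.of_forall fun _ => hθ₀) tendsto_const_nhds)
  simp only [Function.comp_def, momentBlock_psiSample, H.psiPop_inl hθ, H.psiPop_inl hθ₀] at h1 h2
  -- The sample criterion at `u` is at most that at `θ₀`; in the limit this contradicts strict
  -- minimality.
  exact (hmin θ hθ hne).not_ge (le_of_tendsto_of_tendsto h1 h2 ((hu.filter_mono hU).mono fun t ht => ht.2 hθ₀))

/-- Consistency of the double-recentered estimator. -/
theorem IsSmoothMoment.tendsto_of_augBilin_eq_zero (H : IsSmoothMoment F₀ g Θ)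
    (HL : IsLLN F₀ L n x) (hΘ : IsCompact Θ) {W : Matrix (Fin m) (Fin m) ℝ}
    {θ₀ : EuclideanSpace ℝ (Fin p)} [IsProbabilityMeasure F₀]
    (hident : ∀ θ ∈ Θ, θ ≠ θ₀ →
      APop F₀ g W θ₀ *ᵥ (∫ y, (psi g y θ - psiPop F₀ g θ₀) ∂F₀).ofLp ≠ 0) (hθ₀ : θ₀ ∈ Θ)
    {c : T → EuclideanSpace ℝ (Fin m ⊕ Fin m × Fin p)}
    (hc : Tendsto c L (𝓝 (psiPop F₀ g θ₀))) {u : T → EuclideanSpace ℝ (Fin p)}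
    (hu : ∀ᶠ t in L, u t ∈ Θ ∧ augBilin W (c t) (psiSample g (x t) (u t) - c t) = 0) :
    Tendsto u L (𝓝 θ₀) := by
  refine H.tendsto_of_forall_ultrafilter HL hΘ (hu.mono fun _ h => h.1) fun θ hθ U hU hlim => ?_
  by_contra hne
  refine hident θ hθ hne ?_
  have hcU := hc.mono_left hU
  have hpair : Tendsto (fun t => (c t, psiSample g (x t) (u t) - c t)) U
      (𝓝 (psiPop F₀ g θ₀, psiPop F₀ g θ - psiPop F₀ g θ₀)) := hcU.prodMk_nhds (hlim.sub hcU)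
  have h1 := ((augBilin W).continuous₂.tendsto _).comp hpair
  have h0 : ∀ᶠ t in (U : Filter T), (Function.uncurry (fun a b => augBilin W a b) ∘
      fun t => (c t, psiSample g (x t) (u t) - c t)) t = 0 :=
    (hu.filter_mono hU).mono fun t ht => ht.2
  -- The estimating equation passes to the limit by joint continuity of the bilinear map, and
  -- identification excludes it for `θ ≠ θ₀`.
  have h2 : augBilin W (psiPop F₀ g θ₀) (psiPop F₀ g θ - psiPop F₀ g θ₀) = 0 :=
    tendsto_nhds_unique h1 (tendsto_const_nhds.congr' (h0.mono fun t ht => ht.symm))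
  rw [H.augBilin_psiPop W hθ₀] at h2
  rw [integral_sub (H.isDominatedOn_psi.integrable hθ) (integrable_const _), integral_const,
    probReal_univ, one_smul]
  simp only [LinearMap.coe_toContinuousLinearMap', Matrix.toLpLin_apply, WithLp.toLp_eq_zero] at h2
  exact h2

end GMM

/-! ### The main theorem -/

theorem corollary3
    {Ω 𝒳 : Type*} [MeasurableSpace Ω] [MeasurableSpace 𝒳]
    (μ : Measure Ω) [IsProbabilityMeasure μ] (F₀ : Measure 𝒳) [IsProbabilityMeasure F₀]
    {m p : ℕ}
    -- moment functions
    (g : 𝒳 → EuclideanSpace ℝ (Fin p) → EuclideanSpace ℝ (Fin m))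
    (hg_meas : ∀ θ, Measurable fun x => g x θ)
    -- i.i.d. observations with law `F₀`
    (X : ℕ → Ω → 𝒳) (hX_meas : ∀ i, Measurable (X i)) (hX_law : ∀ i, μ.map (X i) = F₀)
    (hX_indep : iIndepFun X μ)
    -- weighting matrix, parameter space, unique pseudo-true value in the interior
    (W : Matrix (Fin m) (Fin m) ℝ) (hW : W.PosDef)
    (Θ : Set (EuclideanSpace ℝ (Fin p))) (hΘ : IsCompact Θ)
    (θW : EuclideanSpace ℝ (Fin p)) (hθW : θW ∈ interior Θ)
    (hθW_min : ∀ θ ∈ Θ, θ ≠ θW →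
      GMM.quad W (GMM.gPop F₀ g θW) < GMM.quad W (GMM.gPop F₀ g θ))
    -- smoothness (which contains the continuity of `g` and `G` on `Θ`) and moment conditions
    (hg_smooth : ∀ᵐ x ∂F₀, ∀ θ ∈ Θ, ContDiffAt ℝ 2 (g x) θ)
    (hg_sup : ∫⁻ x, ⨆ θ ∈ Θ, ‖g x θ‖ₑ ∂F₀ < ∞)
    (hG_sup : ∫⁻ x, ⨆ θ ∈ Θ, ‖GMM.G g x θ‖ₑ ∂F₀ < ∞)
    (hF_sup : ∫⁻ x, ⨆ θ ∈ Θ, ‖GMM.F g x θ‖ₑ ∂F₀ < ∞)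
    (hg_sq : ∫⁻ x, ‖g x θW‖ₑ ^ 2 ∂F₀ < ∞)
    (hG_sq : ∫⁻ x, ‖GMM.G g x θW‖ₑ ^ 2 ∂F₀ < ∞)
    -- identification, with `Λ = A(W, θ_W)`
    (hident : ∀ θ ∈ Θ, θ ≠ θW →
      GMM.APop F₀ g W θW *ᵥ (∫ x, (GMM.psi g x θ - GMM.psiPop F₀ g θW) ∂F₀).ofLp ≠ 0)
    (hrank : IsUnit (GMM.APop F₀ g W θW * GMM.GammaPop F₀ g θW).det)
    -- the GMM estimator
    (θhat : ℕ → Ω → EuclideanSpace ℝ (Fin p)) (hθhat_meas : ∀ n, Measurable (θhat n))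
    (hθhat : ∀ n, ∀ᵐ ω ∂μ, θhat n ω ∈ Θ ∧
      IsMinOn (fun θ => GMM.quad W (GMM.gSample g (GMM.data X n ω) θ)) Θ (θhat n ω))
    -- bootstrap uniform laws of large numbers and bootstrap central limit theorem
    (hboot_g : GMM.TendstoZeroInBootProb μ fun n ω d =>
      ⨆ θ ∈ Θ, ‖GMM.gSample g (GMM.resample (GMM.data X n ω) d) θ -
        GMM.gSample g (GMM.data X n ω) θ‖ₑ)
    (hboot_G : GMM.TendstoZeroInBootProb μ fun n ω d =>
      ⨆ θ ∈ Θ, ‖GMM.GSample g (GMM.resample (GMM.data X n ω) d) θ -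
        GMM.GSample g (GMM.data X n ω) θ‖ₑ)
    (hboot_clt : GMM.TendstoInBootDistribution μ
      (fun n ω d => √(n : ℝ) • GMM.psiBoot g (GMM.data X n ω) d (θhat n ω) (θhat n ω))
      (multivariateGaussian 0 (GMM.SigmaPop F₀ g θW)))
    -- the double-recentered bootstrap estimator: with bootstrap probability tending to one, in
    -- probability, it is a solution in `Θ` of `A_n(W, θhat) ψ̃*_n(θ) = 0`
    (θDR : (n : ℕ) → Ω → (Fin n → Fin n) → EuclideanSpace ℝ (Fin p))
    (hθDR : TendstoInMeasure μ (fun n ω => (GMM.bootLaw n).real {d | θDR n ω d ∈ Θ ∧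
        GMM.ASample g W (GMM.data X n ω) (θhat n ω) *ᵥ
          (GMM.psiBoot g (GMM.data X n ω) d (θhat n ω) (θDR n ω d)).ofLp = 0})
      atTop (fun _ => (1 : ℝ))) :
    -- bootstrap limit law, which is the limit law of the GMM estimator
    GMM.TendstoInBootDistribution μ
      (fun n ω d => √(n : ℝ) • (θDR n ω d - θhat n ω))
      (multivariateGaussian 0 (GMM.VGMM F₀ g W θW)) ∧
    TendstoInDistribution (fun (n : ℕ) ω => √(n : ℝ) • (θhat n ω - θW)) atTop id
      (fun _ => μ) (multivariateGaussian 0 (GMM.VGMM F₀ g W θW)) := by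
  have hθW' := interior_subset hθW
  have hWs : W.IsSymm := by simpa using hW.isHermitian
  have H : GMM.IsSmoothMoment F₀ g Θ := ⟨hg_meas, hg_smooth, hg_sup, hG_sup, hF_sup⟩
  have hψ := H.memLp_psi hθW' hg_sq hG_sq
  have HL := GMM.isLLN_data hX_meas hX_law hX_indep
  have hgauss := GMM.map_multivariateGaussian_SigmaPop W hψ
  have hmin : ∀ᶠ t in GMM.probFilter μ, θhat t.1 t.2 ∈ Θ ∧
      IsMinOn (fun θ => GMM.quad W (GMM.gSample g (GMM.data X t.1 t.2) θ)) Θ (θhat t.1 t.2) :=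
    GMM.eventually_probFilter_of_ae hθhat
  have hcons : Tendsto (fun t : ℕ × Ω => θhat t.1 t.2) (GMM.probFilter μ) (𝓝 θW) :=
    H.tendsto_isMinOn_quad HL hΘ hθW' hθW_min hmin
  have hψhat : Tendsto
      (fun t : ℕ × Ω => GMM.psiSample g (GMM.data X t.1 t.2) (θhat t.1 t.2))
      (GMM.probFilter μ) (𝓝 (GMM.psiPop F₀ g θW)) :=
    H.tendsto_psiSample HL hΘ hθW' (hmin.mono fun _ h => h.1) hcons
  constructor
  · rw [← hgauss]
    have HB := HL.resample
    have hc := hψhat.comp (GMM.tendsto_data_bootFilter (μ := μ))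
    have hsol : ∀ᶠ t in GMM.bootFilter μ, θDR t.1 t.2.1 t.2.2 ∈ Θ ∧
        GMM.augBilin W (GMM.psiSample g (GMM.data X t.1 t.2.1) (θhat t.1 t.2.1))
          (GMM.psiBoot g (GMM.data X t.1 t.2.1) t.2.2 (θhat t.1 t.2.1)
            (θDR t.1 t.2.1 t.2.2)) = 0 := by
      rw [GMM.eventually_bootFilter]
      have h1 := (GMM.tendstoInMeasure_iff_tendsto_probFilter.1 hθDR).const_sub 1
      rw [sub_self] at h1
      refine h1.congr fun t => ?_
      rw [← probReal_compl_eq_one_sub .of_discrete]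
      congr 1
      ext d
      simp [GMM.augBilin_psiSample]
    have hDR := H.tendsto_of_augBilin_eq_zero HB hΘ hident hθW' hc hsol
    -- Here `v = θhat`, the sample is the bootstrap sample, and `ζ = ψ*_n(θhat) - ψ_n(θhat)` is the
    -- quantity in the bootstrap central limit theorem. Adding and subtracting `ψ*_n(θhat)` brings
    -- the equation to the required form.
    have hlin := fun η (hη : (0 : ℝ) < η) => H.eventually_norm_sub_add_le HB hθW hrank hDR
      (hcons.comp GMM.tendsto_data_bootFilter) hc
      (ζ := fun t => GMM.psiBoot g (GMM.data X t.1 t.2.1) t.2.2 (θhat t.1 t.2.1) (θhat t.1 t.2.1))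
      (hsol.mono fun t ht => by
        have := ht.2
        simpa only [GMM.psiBoot, Function.comp_apply, sub_add_sub_cancel] using this) hη
    exact hboot_clt.of_norm_sub_le _ fun η hη => (hlin η hη).mono fun t ht =>
      GMM.norm_smul_sub_map_smul_le _ ht (Real.sqrt_nonneg _)
  · have hclt := GMM.tendstoInDistribution_sqrt_smul_sampleMean_sub hX_meas hX_law hX_indep hψ
    have hfoc : ∀ᶠ t in GMM.probFilter μ,
        GMM.augBilin W (GMM.psiSample g (GMM.data X t.1 t.2) (θhat t.1 t.2))
          (GMM.psiSample g (GMM.data X t.1 t.2) (θhat t.1 t.2)) = 0 := by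
      filter_upwards [hmin, hcons (isOpen_interior.mem_nhds hθW), HL.eventually_ae _ hg_smooth]
        with t ht1 ht2 ht3
      exact GMM.augBilin_psiSample_self_eq_zero
        (fun i => (ht3 i _ ht1.1).differentiableAt (by norm_num))
        (ht1.2.isLocalMin (mem_interior_iff_mem_nhds.1 ht2))
    -- The population first-order condition is obtained as the limit of the sample ones, so no
    -- expectation has to be differentiated.
    have hfoc₀ : GMM.augBilin W (GMM.psiPop F₀ g θW) (GMM.psiPop F₀ g θW) = 0 :=
      tendsto_nhds_unique
        (((GMM.augBilin W).continuous₂.tendsto (_, _)).comp (hψhat.prodMk_nhds hψhat))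
        (tendsto_const_nhds.congr' (hfoc.mono fun t ht => ht.symm))
    -- Polarization: for symmetric `B`, `B(a, a) = B(b, b) = 0` gives `B((a + b)/2, a - b) = 0`. The
    -- midpoint therefore serves as the weight `c`, and it still tends to `ψ(θ_W)`.
    have hc : Tendsto (fun t : ℕ × Ω => (2 : ℝ)⁻¹ •
        (GMM.psiSample g (GMM.data X t.1 t.2) (θhat t.1 t.2) + GMM.psiPop F₀ g θW))
        (GMM.probFilter μ) (𝓝 (GMM.psiPop F₀ g θW)) := by
      have := (hψhat.add_const (GMM.psiPop F₀ g θW)).const_smul (2 : ℝ)⁻¹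
      rwa [← two_smul ℝ, inv_smul_smul₀ two_ne_zero] at this
    have hlin := fun η (hη : (0 : ℝ) < η) => H.eventually_norm_sub_add_le HL hθW hrank hcons
      (v := fun _ => θW) tendsto_const_nhds hc
      (ζ := fun t => GMM.psiSample g (GMM.data X t.1 t.2) θW - GMM.psiPop F₀ g θW)
      (hfoc.mono fun t ht => by
        simp only [sub_add_sub_cancel, map_smul, map_add, map_sub, smul_apply, add_apply, ht,
          hfoc₀, GMM.augBilin_comm hWs (GMM.psiPop F₀ g θW)]
        simp) hη
    exact GMM.tendstoInDistribution_of_norm_sub_le hclt _ hgauss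
      (fun n => (((hθhat_meas n).sub_const θW).const_smul (√(n : ℝ))).aemeasurable)
      fun η hη => (hlin η hη).mono fun t ht =>
        GMM.norm_smul_sub_map_smul_le _ ht (Real.sqrt_nonneg _)
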